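/- A polygon with $N$ sides is given by its vertices $P_0,P_1,\dots,P_{N-1}$ in the Euclidean plane, with sides $P_iP_{i+1}$ (indices modulo $N$). It is simple if its boundary, traversed once, passes through no point twice; its interior is then the bounded region enclosed by the boundary, and the interior angle at a vertex is the angle in $(0,2\pi)$ measured inside this region. The polygon is convex if its interior is a convex set. An arithmetic polygon is a polygon with a distinguished vertex $O=P_0$ and positive integer side lengths such that: (1) traversing the polygon starting and finishing at $O$ (in one of the two directions, the one used for the labelling), each side has length one greater than the preceding side; (2) for each side there is a line perpendicular to that side which passes through $O$ and through one of the two endpoints of that side; (3) no vertex has an angle equal to $0$ or $\pi$. **Theorem 3.2.** Let $\mathcal P$ be a simple arithmetic polygon with $N$ sides, and let $\mu(\mathcal P)$ be the number of interior angles of $\mathcal P$ which are greater than $\pi$. For every real number $\nu$, if $\mu(\mathcal P)\le\nu$, then $$N\le 8+3\pi^2(\nu+2)^2 .$$ In particular, every convex simple arithmetic polygon has at most $126$ sides. -/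

import Mathlib

open Real Set Filter Topology MeasureTheory

namespace Polygon

variable {N : ℕ}

/-- The polygon does not intersect itself: its closed boundary curve, obtained by running through
the half-open edges one after the other, passes through no point of the plane twice. -/
def IsSimple (P : Polygon ℂ N) : Prop :=
  ∀ i j : Fin N, ∀ s ∈ Ico (0 : ℝ) 1, ∀ t ∈ Ico (0 : ℝ) 1,
    P.edgePath ℝ i s = P.edgePath ℝ j t → i = j ∧ s = t

/-- The region enclosed by the polygon: the points off the boundary whose connected component
in the complement of the boundary is bounded. -/
def inside (P : Polygon ℂ N) : Set ℂ :=
  {z | z ∉ P.boundary ℝ ∧ Bornology.IsBounded (connectedComponentIn (P.boundary ℝ)ᶜ z)}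

/-- The directions `θ` (angles modulo `2π`, represented in `(-π, π]`) that point from the `i`-th
vertex into the enclosed region. -/
def inwardDirections (P : Polygon ℂ N) (i : Fin N) : Set ℝ :=
  {θ ∈ Ioc (-π) π | ∀ᶠ t : ℝ in 𝓝[>] 0, P i + t * Complex.exp (θ * Complex.I) ∈ P.inside}

/-- The interior angle at the `i`-th vertex, a number between `0` and `2π`: the total angular
measure of the directions that point from the vertex into the enclosed region. -/
noncomputable def interiorAngle (P : Polygon ℂ N) (i : Fin N) : ℝ :=
  volume.real (P.inwardDirections i)

/-- The number of interior angles that are greater than `π`. -/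
noncomputable def reflexCount (P : Polygon ℂ N) : ℕ :=
  Set.ncard {i : Fin N | π < P.interiorAngle i}

/-- The polygon is convex: the region that it encloses is a convex set. -/
def IsConvex (P : Polygon ℂ N) : Prop :=
  Convex ℝ P.inside

/-- An arithmetic polygon in the Euclidean plane `ℂ`. The vertices are listed in cyclic order
starting from the special vertex `O = P 0`, in the direction in which the side lengths increase;
the `i`-th side joins `P i` to `P (i + 1)`, indices being read modulo `N`. -/
structure IsArithmetic [NeZero N] (P : Polygon ℂ N) : Prop where
  /-- The side lengths are positive integers `a + 1, a + 2, …, a + N`, in this order from `O`. -/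
  sides : ∃ a : ℕ, ∀ i : Fin N, dist (P i) (P (i + 1)) = (a : ℝ) + 1 + ((i : ℕ) : ℝ)
  /-- For each side there is a line perpendicular to it which passes through `O` and through one
  of the two end points of the side. -/
  perpendicular : ∀ i : Fin N, ∃ l : AffineSubspace ℝ ℂ,
    Module.finrank ℝ l.direction = 1 ∧
    l.direction ⟂ (affineSpan ℝ {P i, P (i + 1)}).direction ∧
    P 0 ∈ l ∧ (P i ∈ l ∨ P (i + 1) ∈ l)
  /-- No vertex, `O` included, has an angle of `0` or `π`. -/
  nondegenerate : ∀ i : Fin N,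
    EuclideanGeometry.angle (P (i - 1)) (P i) (P (i + 1)) ≠ 0 ∧
    EuclideanGeometry.angle (P (i - 1)) (P i) (P (i + 1)) ≠ π

end Polygon

/-! Put `O` at the origin. Every side is perpendicular to the radius at one of its ends. If a side
is perpendicular at its far end, the next side cannot be perpendicular at that same vertex, since
the angle there would be `0` or `π`. So the polygon runs outwards up to some vertex `m` and then
comes back (`exists_turning_vertex`). The outgoing part and the reversed return part are both
spirals `q (j + 1) = q j * (1 + t j * I)`.

Distance from `O` increases strictly along a spiral, so a spiral is a graph in polar coordinates:
its angle is a continuous function `sweep` of the radius. Simplicity says that the two angle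
functions never differ by a multiple of `2π` before the common end, where they agree. Hence one
stays ahead of the other by less than `2π` (`exists_isSpiralPair`), and the points between them are
enclosed. At a vertex where the lower spiral turns negatively, or the upper one positively, the
enclosed region has an angle greater than `π`.

The signed turnings, upper subtracted from lower, add up to the initial gap, which is at most `2π`.
Each turn of the wrong sign costs at most `π` on passing to absolute values, so the total absolute
turning is at most `π * (μ + 2)` (`sum_abs_arctan_le`).

Conversely, by Pythagoras `‖q j‖ ^ 2` is the sum of the first `j` squared lengths, so increasing
lengths give `t j ^ 2 ≥ 1 / j` on the outgoing part, whose turning is thus at least `2 * (√(m + 1) -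
√2)`. The return sides are longer but have the same sum of squares, so there are fewer of them and
`N < 2 * m`. Comparing the two bounds gives the result. -/

/-! ### Spirals as polar graphs over the radius. -/

/-- A spiral around the origin: after the radial segment from `0` to `q 1`, each segment from `q j`
to `q (j + 1)` is perpendicular to `q j`, with signed slope `t j`. -/
structure IsSpiral (q : ℕ → ℂ) (t : ℕ → ℝ) (n : ℕ) : Prop where
  pos : 1 ≤ n
  zero : q 0 = 0
  one_ne : q 1 ≠ 0
  slope_ne : ∀ j, 1 ≤ j → j < n → t j ≠ 0
  step : ∀ j, 1 ≤ j → j < n → q (j + 1) = q j * (1 + t j * Complex.I)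

/-- The angle swept by a spiral from its start up to the distance `r` from the origin. -/
noncomputable def sweep (q : ℕ → ℂ) (t : ℕ → ℝ) (n : ℕ) (r : ℝ) : ℝ :=
  ∑ j ∈ Finset.Ico 1 n, arctan (t j * min 1 (√(r ^ 2 - ‖q j‖ ^ 2) / (‖q j‖ * |t j|)))

theorem one_add_mul_I_eq_sqrt_mul_exp (x : ℝ) :
    (1 + x * Complex.I : ℂ) = (√(1 + x ^ 2) : ℝ) * Complex.exp (arctan x * Complex.I) := by
  have h : √(1 + x ^ 2) ≠ 0 := by positivity
  rw [Complex.exp_mul_I, ← Complex.ofReal_cos, ← Complex.ofReal_sin, cos_arctan, sin_arctan]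
  have h' : ((√(1 + x ^ 2) : ℝ) : ℂ) ≠ 0 := by exact_mod_cast h
  push_cast
  field_simp

theorem norm_one_add_mul_I (x : ℝ) : ‖(1 + x * Complex.I : ℂ)‖ = √(1 + x ^ 2) := by
  rw [one_add_mul_I_eq_sqrt_mul_exp, norm_mul, Complex.norm_exp_ofReal_mul_I, mul_one,
    Complex.norm_real, norm_of_nonneg (sqrt_nonneg _)]

theorem continuous_sweep (q : ℕ → ℂ) (t : ℕ → ℝ) (n : ℕ) : Continuous (sweep q t n) := by
  unfold sweep
  fun_prop

namespace IsSpiral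

variable {q : ℕ → ℂ} {t : ℕ → ℝ} {n : ℕ}

theorem norm_succ (h : IsSpiral q t n) {j : ℕ} (h1 : 1 ≤ j) (hj : j < n) :
    ‖q (j + 1)‖ = ‖q j‖ * √(1 + t j ^ 2) := by
  rw [h.step j h1 hj, norm_mul, norm_one_add_mul_I]

theorem norm_pos (h : IsSpiral q t n) {j : ℕ} (h1 : 1 ≤ j) (hj : j ≤ n) : 0 < ‖q j‖ := by
  induction j, h1 using Nat.le_induction with
  | base => exact norm_pos_iff.2 h.one_ne
  | succ j h1 ih =>
    rw [h.norm_succ h1 (by lia)]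
    have := ih (by lia)
    positivity

theorem norm_lt_succ (h : IsSpiral q t n) {j : ℕ} (hj : j < n) : ‖q j‖ < ‖q (j + 1)‖ := by
  rcases Nat.eq_zero_or_pos j with rfl | h1
  · simpa [h.zero] using h.one_ne
  · rw [h.norm_succ h1 hj]
    have h2 := h.norm_pos h1 hj.le
    have h3 : 0 < t j ^ 2 := by have := h.slope_ne j h1 hj; positivity
    have h4 : 1 < √(1 + t j ^ 2) := by
      rw [Real.lt_sqrt (by norm_num)]; linarith
    nlinarith

theorem norm_mono (h : IsSpiral q t n) {i j : ℕ} (hij : i ≤ j) (hj : j ≤ n) : ‖q i‖ ≤ ‖q j‖ := by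
  induction j, hij using Nat.le_induction with
  | base => rfl
  | succ j hij ih => exact (ih (by lia)).trans (h.norm_lt_succ (by lia)).le

theorem norm_strictMono (h : IsSpiral q t n) {i j : ℕ} (hij : i < j) (hj : j ≤ n) :
    ‖q i‖ < ‖q j‖ :=
  (h.norm_lt_succ (by lia)).trans_le (h.norm_mono hij hj)

/-- The factor `min 1 (…)` in `sweep` is the fraction of segment `i` lying in the disc of radius
`r`: the cap `1` handles segments already completed, and `√` of a negative number being `0` handles
those not yet reached. -/
theorem sweep_term_eq_of_norm_succ_le (h : IsSpiral q t n) {i : ℕ} (h1 : 1 ≤ i) (hi : i < n) {r : ℝ}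
    (hr : ‖q (i + 1)‖ ≤ r) :
    arctan (t i * min 1 (√(r ^ 2 - ‖q i‖ ^ 2) / (‖q i‖ * |t i|))) = arctan (t i) := by
  have h2 := h.norm_pos h1 hi.le
  have h3 : 0 < |t i| := abs_pos.2 (h.slope_ne i h1 hi)
  rw [min_eq_left, mul_one]
  rw [le_div_iff₀ (by positivity), one_mul]
  apply Real.le_sqrt_of_sq_le
  have h4 : ‖q (i + 1)‖ ^ 2 ≤ r ^ 2 := by gcongr
  rw [h.norm_succ h1 hi, mul_pow, Real.sq_sqrt (by positivity)] at h4
  rw [mul_pow, sq_abs]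
  linarith

theorem sweep_term_eq_of_le_norm {ρ c r : ℝ} (h0 : 0 ≤ r) (hr : r ≤ ρ) :
    arctan (c * min 1 (√(r ^ 2 - ρ ^ 2) / (ρ * |c|))) = 0 := by
  rw [Real.sqrt_eq_zero_of_nonpos (by nlinarith)]
  simp

/-- Only the segment that crosses the circle of radius `r` contributes a partial angle. -/
theorem sweep_eq (h : IsSpiral q t n) {j : ℕ} (h1 : 1 ≤ j) (hj : j < n) {r : ℝ}
    (hr : ‖q j‖ ≤ r) (hr' : r ≤ ‖q (j + 1)‖) :
    sweep q t n r = ∑ i ∈ Finset.Ico 1 j, arctan (t i) +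
      arctan (t j * min 1 (√(r ^ 2 - ‖q j‖ ^ 2) / (‖q j‖ * |t j|))) := by
  have h0 : 0 ≤ r := (norm_nonneg _).trans hr
  unfold sweep
  rw [← Finset.sum_Ico_consecutive _ h1 hj.le, Finset.sum_eq_sum_Ico_succ_bot hj]
  congr 1
  · refine Finset.sum_congr rfl fun i hi => ?_
    rw [Finset.mem_Ico] at hi
    exact h.sweep_term_eq_of_norm_succ_le hi.1 (by lia)
      ((h.norm_mono (by lia : i + 1 ≤ j) hj.le).trans hr)
  · rw [add_eq_left]
    refine Finset.sum_eq_zero fun i hi => ?_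
    rw [Finset.mem_Ico] at hi
    exact sweep_term_eq_of_le_norm h0 (hr'.trans (h.norm_mono hi.1 (by lia)))

theorem sweep_eq_zero (h : IsSpiral q t n) {r : ℝ} (h0 : 0 ≤ r) (hr : r ≤ ‖q 1‖) :
    sweep q t n r = 0 := by
  refine Finset.sum_eq_zero fun i hi => ?_
  rw [Finset.mem_Ico] at hi
  exact sweep_term_eq_of_le_norm h0 (hr.trans (h.norm_mono hi.1 (by lia)))

theorem sweep_norm_end (h : IsSpiral q t n) :
    sweep q t n ‖q n‖ = ∑ i ∈ Finset.Ico 1 n, arctan (t i) := by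
  refine Finset.sum_congr rfl fun i hi => ?_
  rw [Finset.mem_Ico] at hi
  exact h.sweep_term_eq_of_norm_succ_le hi.1 (by lia) (h.norm_mono (by lia) le_rfl)

theorem lineMap_eq (h : IsSpiral q t n) {j : ℕ} (h1 : 1 ≤ j) (hj : j < n) (s : ℝ) :
    AffineMap.lineMap (q j) (q (j + 1)) s = q j * (1 + ((s * t j : ℝ) : ℂ) * Complex.I) := by
  rw [h.step j h1 hj, AffineMap.lineMap_apply]
  simp only [vsub_eq_sub, vadd_eq_add, Complex.real_smul]
  push_cast
  ring

theorem norm_lineMap (h : IsSpiral q t n) {j : ℕ} (h1 : 1 ≤ j) (hj : j < n) (s : ℝ) :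
    ‖(AffineMap.lineMap (q j) (q (j + 1)) s : ℂ)‖ = ‖q j‖ * √(1 + (s * t j) ^ 2) := by
  rw [h.lineMap_eq h1 hj, norm_mul, norm_one_add_mul_I]

theorem norm_lineMap_zero (h : IsSpiral q t n) {s : ℝ} (hs : 0 ≤ s) :
    ‖(AffineMap.lineMap (q 0) (q 1) s : ℂ)‖ = s * ‖q 1‖ := by
  rw [AffineMap.lineMap_apply, h.zero]
  simp [abs_of_nonneg hs]

theorem norm_lineMap_mem (h : IsSpiral q t n) {j : ℕ} (hj : j < n) {s : ℝ} (hs : s ∈ Icc (0 : ℝ) 1) :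
    ‖(AffineMap.lineMap (q j) (q (j + 1)) s : ℂ)‖ ∈ Icc ‖q j‖ ‖q (j + 1)‖ := by
  rcases Nat.eq_zero_or_pos j with rfl | h1
  · rw [h.norm_lineMap_zero hs.1, h.zero, norm_zero]
    exact ⟨mul_nonneg hs.1 (norm_nonneg _), mul_le_of_le_one_left (norm_nonneg _) hs.2⟩
  · rw [h.norm_lineMap h1 hj, h.norm_succ h1 hj]
    constructor
    · apply le_mul_of_one_le_right (norm_nonneg _)
      rw [Real.one_le_sqrt]
      nlinarith [sq_nonneg (s * t j)]
    · refine mul_le_mul_of_nonneg_left (Real.sqrt_le_sqrt ?_) (norm_nonneg _)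
      rw [add_le_add_iff_left, mul_pow]
      exact mul_le_of_le_one_left (sq_nonneg _) (pow_le_one₀ hs.1 hs.2)

theorem sweep_norm_lineMap (h : IsSpiral q t n) {j : ℕ} (h1 : 1 ≤ j) (hj : j < n) {s : ℝ}
    (hs : s ∈ Icc (0 : ℝ) 1) :
    sweep q t n ‖(AffineMap.lineMap (q j) (q (j + 1)) s : ℂ)‖ =
      ∑ i ∈ Finset.Ico 1 j, arctan (t i) + arctan (s * t j) := by
  have h2 := h.norm_lineMap_mem hj hs
  rw [h.sweep_eq h1 hj h2.1 h2.2]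
  have h3 := h.norm_pos h1 hj.le
  have h4 : 0 < |t j| := abs_pos.2 (h.slope_ne j h1 hj)
  have h5 : ‖(AffineMap.lineMap (q j) (q (j + 1)) s : ℂ)‖ ^ 2 - ‖q j‖ ^ 2 =
      (‖q j‖ * |t j| * s) ^ 2 := by
    rw [h.norm_lineMap h1 hj, mul_pow, Real.sq_sqrt (by positivity), mul_pow, mul_pow, mul_pow,
      sq_abs]
    ring
  have h6 := hs.1
  rw [h5, Real.sqrt_sq (by positivity), mul_div_cancel_left₀ _ (by positivity), min_eq_right hs.2,
    mul_comm s]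

theorem vertex_eq (h : IsSpiral q t n) {α : ℝ} (hα : q 1 = ‖q 1‖ * Complex.exp (α * Complex.I))
    {j : ℕ} (h1 : 1 ≤ j) (hj : j ≤ n) :
    q j = ‖q j‖ * Complex.exp ((α + ∑ i ∈ Finset.Ico 1 j, arctan (t i) : ℝ) * Complex.I) := by
  induction j, h1 using Nat.le_induction with
  | base => simpa using hα
  | succ j h1 ih =>
    rw [Finset.sum_Ico_succ_top h1, h.norm_succ h1 (by lia), h.step j h1 (by lia),
      one_add_mul_I_eq_sqrt_mul_exp]
    nth_rw 1 [ih (by lia)]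
    have : ∀ x y z : ℝ, Complex.exp ((x + (y + z) : ℝ) * Complex.I) =
        Complex.exp ((x + y : ℝ) * Complex.I) * Complex.exp (z * Complex.I) := by
      intro x y z
      rw [← Complex.exp_add]; congr 1; push_cast; ring
    rw [this]
    push_cast
    ring

/-- Every point of a spiral is determined by its distance from the origin. -/
theorem lineMap_eq_norm_mul_exp (h : IsSpiral q t n) {α : ℝ}
    (hα : q 1 = ‖q 1‖ * Complex.exp (α * Complex.I)) {j : ℕ} (hj : j < n) {s : ℝ}
    (hs : s ∈ Icc (0 : ℝ) 1) {z : ℂ} (hz : AffineMap.lineMap (q j) (q (j + 1)) s = z) :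
    z = ‖z‖ * Complex.exp ((α + sweep q t n ‖z‖ : ℝ) * Complex.I) := by
  subst hz
  rcases Nat.eq_zero_or_pos j with rfl | h1
  · have h2 := h.norm_lineMap_mem hj hs
    rw [h.sweep_eq_zero (norm_nonneg _) h2.2, zero_add, h.norm_lineMap_zero hs.1, add_zero,
      AffineMap.lineMap_apply, h.zero]
    simp only [vsub_eq_sub, vadd_eq_add, Complex.real_smul, sub_zero, add_zero]
    nth_rw 1 [hα]
    push_cast
    ring
  · rw [h.sweep_norm_lineMap h1 hj hs, h.norm_lineMap h1 hj, h.lineMap_eq h1 hj,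
      one_add_mul_I_eq_sqrt_mul_exp]
    nth_rw 1 [h.vertex_eq hα h1 hj.le]
    have : ∀ x y z : ℝ, Complex.exp ((x + (y + z) : ℝ) * Complex.I) =
        Complex.exp ((x + y : ℝ) * Complex.I) * Complex.exp (z * Complex.I) := by
      intro x y z
      rw [← Complex.exp_add]; congr 1; push_cast; ring
    rw [this]
    push_cast
    ring

theorem exists_lineMap_norm_eq (h : IsSpiral q t n) {r : ℝ} (h0 : 0 ≤ r) (hr : r < ‖q n‖) :
    ∃ j < n, ∃ s ∈ Ico (0 : ℝ) 1, ‖(AffineMap.lineMap (q j) (q (j + 1)) s : ℂ)‖ = r := by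
  classical
  have hex : ∃ k, r < ‖q k‖ := ⟨n, hr⟩
  -- Segment `j` ends at the first vertex outside the closed disc of radius `r`.
  obtain ⟨j, hj⟩ : ∃ j, Nat.find hex = j + 1 := by
    refine Nat.exists_eq_succ_of_ne_zero fun h' => ?_
    have := Nat.find_spec hex
    rw [h', h.zero, norm_zero] at this
    linarith
  have h1 : r < ‖q (j + 1)‖ := hj ▸ Nat.find_spec hex
  have h2 : ‖q j‖ ≤ r := not_lt.1 (Nat.find_min hex (by lia))
  have h3 : Nat.find hex ≤ n := Nat.find_min' hex hr
  refine ⟨j, by lia, ?_⟩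
  have hc : Continuous fun s : ℝ => ‖(AffineMap.lineMap (q j) (q (j + 1)) s : ℂ)‖ := by
    fun_prop
  have := intermediate_value_Ico (zero_le_one' ℝ) hc.continuousOn
  simp only [AffineMap.lineMap_apply_zero, AffineMap.lineMap_apply_one] at this
  obtain ⟨s, hs, hs'⟩ := this ⟨h2, h1⟩
  exact ⟨s, hs, hs'⟩

theorem exists_lineMap_eq (h : IsSpiral q t n) {α : ℝ}
    (hα : q 1 = ‖q 1‖ * Complex.exp (α * Complex.I)) {r : ℝ} (h0 : 0 ≤ r) (hr : r < ‖q n‖) :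
    ∃ j < n, ∃ s ∈ Ico (0 : ℝ) 1, AffineMap.lineMap (q j) (q (j + 1)) s =
      (r : ℂ) * Complex.exp ((α + sweep q t n r : ℝ) * Complex.I) := by
  obtain ⟨j, hj, s, hs, rfl⟩ := h.exists_lineMap_norm_eq h0 hr
  exact ⟨j, hj, s, hs, h.lineMap_eq_norm_mul_exp hα hj ⟨hs.1, hs.2.le⟩ rfl⟩

theorem end_eq (h : IsSpiral q t n) {α : ℝ} (hα : q 1 = ‖q 1‖ * Complex.exp (α * Complex.I)) :
    q n = ‖q n‖ * Complex.exp ((α + sweep q t n ‖q n‖ : ℝ) * Complex.I) := by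
  rw [h.sweep_norm_end]
  exact h.vertex_eq hα h.pos le_rfl

end IsSpiral

/-! ### The region between two polar graphs. -/

/-- The points at distance `r < R` from `c` in directions strictly between `f r` and `g r`. -/
def angularRegion (c : ℂ) (f g : ℝ → ℝ) (R : ℝ) : Set ℂ :=
  {z | ∃ r ∈ Ioo 0 R, ∃ φ ∈ Ioo (f r) (g r), z = c + r * Complex.exp (φ * Complex.I)}

section angularRegion

variable {c : ℂ} {f g : ℝ → ℝ} {R : ℝ}

theorem isOpen_angularRegion (hf : Continuous f) (hg : Continuous g) :
    IsOpen (angularRegion c f g R) := by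
  -- In logarithmic polar coordinates the region is the image under the open map `exp` of a set cut
  -- out by strict inequalities.
  have h1 : angularRegion c f g R = (fun z => c + z) '' (Complex.exp ''
      {w | rexp w.re < R ∧ f (rexp w.re) < w.im ∧ w.im < g (rexp w.re)}) := by
    ext z
    constructor
    · rintro ⟨r, hr, φ, hφ, rfl⟩
      refine ⟨_, ⟨⟨Real.log r, φ⟩, ?_, rfl⟩, ?_⟩
      · simpa [Real.exp_log hr.1] using ⟨hr.2, hφ⟩
      · change c + Complex.exp ⟨Real.log r, φ⟩ = _
        rw [Complex.exp_eq_exp_re_mul_sin_add_cos, ← Complex.ofReal_exp, Real.exp_log hr.1,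
          Complex.exp_mul_I]
    · rintro ⟨_, ⟨w, hw, rfl⟩, rfl⟩
      refine ⟨rexp w.re, ⟨Real.exp_pos _, hw.1⟩, w.im, hw.2, ?_⟩
      change c + Complex.exp w = _
      rw [Complex.exp_eq_exp_re_mul_sin_add_cos, Complex.exp_mul_I, Complex.ofReal_exp]
  rw [h1]
  refine (Homeomorph.addLeft c).isOpenMap _ (Complex.isOpenMap_exp _ ?_)
  refine IsOpen.inter (isOpen_lt (Real.continuous_exp.comp Complex.continuous_re) continuous_const)
    (IsOpen.inter (isOpen_lt ?_ Complex.continuous_im) (isOpen_lt Complex.continuous_im ?_))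
  · exact hf.comp (Real.continuous_exp.comp Complex.continuous_re)
  · exact hg.comp (Real.continuous_exp.comp Complex.continuous_re)

theorem isBounded_angularRegion : Bornology.IsBounded (angularRegion c f g R) := by
  refine (Metric.isBounded_closedBall (x := c) (r := R)).subset ?_
  rintro _ ⟨r, hr, φ, -, rfl⟩
  simp [Complex.norm_exp_ofReal_mul_I, abs_of_pos hr.1, hr.2.le]

/-- The region lies in a compact image of the rectangle `[0, R] × [0, 1]`, whose four sides are sent
into `K`; the side `r = R` is sent to a single point because `f R = g R`. -/
theorem closure_angularRegion_subset (hf : Continuous f) (hg : Continuous g)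
    (hlt : ∀ r ∈ Ioo 0 R, f r < g r) (hR : f R = g R) {K : Set ℂ}
    (hfK : ∀ r ∈ Icc 0 R, c + r * Complex.exp (f r * Complex.I) ∈ K)
    (hgK : ∀ r ∈ Icc 0 R, c + r * Complex.exp (g r * Complex.I) ∈ K) :
    closure (angularRegion c f g R) ⊆ angularRegion c f g R ∪ K := by
  let F : ℝ × ℝ → ℂ := fun p =>
    c + p.1 * Complex.exp (((f p.1 + p.2 * (g p.1 - f p.1) : ℝ) : ℂ) * Complex.I)
  have hF : Continuous F := by fun_prop
  have hc : IsClosed (F '' (Icc 0 R ×ˢ Icc 0 1)) :=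
    ((isCompact_Icc.prod isCompact_Icc).image hF).isClosed
  refine (closure_minimal ?_ hc).trans ?_
  · rintro _ ⟨r, hr, φ, hφ, rfl⟩
    have h1 : 0 < g r - f r := by linarith [hlt r hr]
    refine ⟨(r, (φ - f r) / (g r - f r)), ⟨⟨hr.1.le, hr.2.le⟩, ?_, ?_⟩, ?_⟩
    · exact div_nonneg (by linarith [hφ.1]) h1.le
    · exact (div_le_one h1).2 (by linarith [hφ.2])
    · simp only [F]
      rw [div_mul_cancel₀ _ h1.ne']
      congr 5
      ring
  · rintro _ ⟨⟨r, s⟩, ⟨hr, hs⟩, rfl⟩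
    simp only [F] at hr hs ⊢
    rcases hr.1.eq_or_lt with h0 | h0
    · right
      have := hfK r hr
      rw [← h0] at this ⊢
      simpa using this
    rcases hr.2.eq_or_lt with h1 | h1
    · right
      have := hfK r hr
      rw [h1] at this ⊢
      simpa [hR] using this
    rcases hs.1.eq_or_lt with h2 | h2
    · right
      have := hfK r hr
      rw [← h2]
      simpa using this
    rcases hs.2.eq_or_lt with h3 | h3
    · right
      have := hgK r hr
      rw [h3]
      simpa using this
    · left
      have h4 := hlt r ⟨h0, h1⟩
      refine ⟨r, ⟨h0, h1⟩, _, ⟨?_, ?_⟩, rfl⟩ <;> nlinarith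

/-- A connected set avoiding `K` cannot leave the open region, whose limit points outside itself are
all in `K`. -/
theorem isBounded_connectedComponentIn_of_mem_angularRegion (hf : Continuous f) (hg : Continuous g)
    (hlt : ∀ r ∈ Ioo 0 R, f r < g r) (hR : f R = g R) {K : Set ℂ}
    (hfK : ∀ r ∈ Icc 0 R, c + r * Complex.exp (f r * Complex.I) ∈ K)
    (hgK : ∀ r ∈ Icc 0 R, c + r * Complex.exp (g r * Complex.I) ∈ K)
    (hdisj : Disjoint (angularRegion c f g R) K) {z : ℂ} (hz : z ∈ angularRegion c f g R) :
    Bornology.IsBounded (connectedComponentIn Kᶜ z) := by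
  have hz' : z ∈ Kᶜ := disjoint_left.1 hdisj hz
  refine isBounded_angularRegion.subset (s := connectedComponentIn Kᶜ z)
    (isPreconnected_connectedComponentIn.subset_of_closure_inter_subset
      (isOpen_angularRegion hf hg) ⟨z, mem_connectedComponentIn hz', hz⟩ ?_)
  rintro w ⟨hw, hw'⟩
  exact (closure_angularRegion_subset hf hg hlt hR hfK hgK hw).resolve_right
    (connectedComponentIn_subset _ _ hw')

theorem disjoint_angularRegion (hlt : ∀ r ∈ Ioo 0 R, g r < f r + 2 * π) {K : Set ℂ}
    (hK : ∀ z ∈ K, z = c + ‖z - c‖ * Complex.exp (f ‖z - c‖ * Complex.I) ∨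
      z = c + ‖z - c‖ * Complex.exp (g ‖z - c‖ * Complex.I)) :
    Disjoint (angularRegion c f g R) K := by
  rw [disjoint_left]
  rintro _ ⟨r, hr, φ, hφ, rfl⟩ hz
  have h1 : ‖c + r * Complex.exp (φ * Complex.I) - c‖ = r := by
    simp [Complex.norm_exp_ofReal_mul_I, abs_of_pos hr.1]
  have h2 := hK _ hz
  rw [h1] at h2
  have h3 : (r : ℂ) ≠ 0 := by exact_mod_cast hr.1.ne'
  have key : ∀ ψ : ℝ, c + r * Complex.exp (φ * Complex.I) = c + r * Complex.exp (ψ * Complex.I) →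
      ∃ k : ℤ, φ = ψ + k * (2 * π) := by
    intro ψ h
    have h4 := mul_left_cancel₀ h3 (add_left_cancel h)
    obtain ⟨k, hk⟩ := Complex.exp_eq_exp_iff_exists_int.1 h4
    refine ⟨k, ?_⟩
    have := congrArg Complex.im hk
    simpa using this
  have hp := Real.two_pi_pos
  have h5 := hlt r hr
  rcases h2 with h2 | h2 <;> obtain ⟨k, hk⟩ := key _ h2
  · have h6 : (0 : ℝ) < k := by
      by_contra! h
      nlinarith [hφ.1]
    have h7 : (k : ℝ) < 1 := by
      by_contra! h
      nlinarith [hφ.2]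
    norm_cast at h6 h7
    lia
  · have h6 : (-1 : ℝ) < k := by
      by_contra! h
      nlinarith [hφ.1]
    have h7 : (k : ℝ) < 0 := by
      by_contra! h
      nlinarith [hφ.2]
    norm_cast at h6 h7
    lia

end angularRegion

/-! ### Angles greater than `π` where a curve turns away. -/

theorem div_sqrt_one_add_sq_le_arctan {x : ℝ} (hx : 0 ≤ x) : x / √(1 + x ^ 2) ≤ arctan x := by
  rw [← sin_arctan]
  exact Real.sin_le (Real.arctan_nonneg.2 hx)

/-- If membership in a set of angles is detected by all their lifts to `T`, an interval of length at
most `2π`, then the set is at least as large as `T`. -/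
theorem volume_le_of_forall_add_int_mul {S T : Set ℝ} {a : ℝ} (hTm : MeasurableSet T)
    (hT : T ⊆ Ioc a (a + 2 * π))
    (h : ∀ θ ∈ Ioc (-π) π, ∀ k : ℤ, θ + k * (2 * π) ∈ T → θ ∈ S) : volume T ≤ volume S := by
  let A : Set ℝ := ⋃ k : ℤ, (fun x => x + k * (2 * π)) ⁻¹' T
  have hA : MeasurableSet A :=
    MeasurableSet.iUnion fun k => hTm.preimage (measurable_id.add_const _)
  -- `A` is invariant under translation by `2π`, so it has the same measure in every period.
  have h2 := (isAddFundamentalDomain_Ioc Real.two_pi_pos a).measure_set_eq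
    (isAddFundamentalDomain_Ioc Real.two_pi_pos (-π)) hA (by
      rintro ⟨_, k, rfl⟩
      ext x
      simp only [A, mem_preimage, mem_iUnion]
      constructor
      · rintro ⟨l, hl⟩
        refine ⟨l + k, ?_⟩
        convert hl using 1
        simp [AddSubgroup.vadd_def]
        ring
      · rintro ⟨l, hl⟩
        refine ⟨l - k, ?_⟩
        convert hl using 1
        simp [AddSubgroup.vadd_def]
        ring)
  have h3 : T ⊆ A ∩ Ioc a (a + 2 * π) := fun x hx =>
    ⟨mem_iUnion.2 ⟨0, by simpa using hx⟩, hT hx⟩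
  refine (measure_mono h3).trans (h2.trans_le (measure_mono ?_))
  rintro θ ⟨hθ, hθ'⟩
  obtain ⟨k, hk⟩ := mem_iUnion.1 hθ
  exact h θ (by rwa [show -π + 2 * π = π by ring] at hθ') k hk

theorem one_add_mul_exp_eq (τ ω s : ℝ) (hs : s = 1 ∨ s = -1) :
    (1 + τ * Complex.exp ((s * ω : ℝ) * Complex.I) : ℂ) =
      ⟨1 + τ * cos ω, s * (τ * sin ω)⟩ := by
  have h : cos (s * ω) = cos ω ∧ sin (s * ω) = s * sin ω := by rcases hs with rfl | rfl <;> simp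
  apply Complex.ext <;>
    simp [h, mul_left_comm, Complex.exp_ofReal_mul_I_re, Complex.exp_ofReal_mul_I_im, -neg_mul, -Complex.ofReal_neg,
      -Complex.ofReal_mul]

theorem sign_mul_arg_mk (x y s : ℝ) (hx : 0 < x) (hs : s = 1 ∨ s = -1) :
    s * Complex.arg ⟨x, s * y⟩ = arctan (y / x) := by
  have h1 : |Complex.arg ⟨x, s * y⟩| < π / 2 := Complex.abs_arg_lt_pi_div_two_iff.2 (Or.inl hx)
  rw [← Real.arctan_tan (abs_lt.1 h1).1 (abs_lt.1 h1).2, Complex.tan_arg]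
  rcases hs with rfl | rfl <;> simp [neg_div, Real.arctan_neg]

theorem norm_mk_sign_mul (x y s : ℝ) (hs : s = 1 ∨ s = -1) :
    ‖(⟨x, s * y⟩ : ℂ)‖ = √(x ^ 2 + y ^ 2) := by
  rw [Complex.norm_def, Complex.normSq_mk]
  congr 1
  rcases hs with rfl | rfl <;> ring

theorem tendsto_one_add_mul_cos (ω : ℝ) :
    Tendsto (fun τ : ℝ => 1 + τ * cos ω) (𝓝[>] 0) (𝓝 1) := by
  have : Continuous fun τ : ℝ => 1 + τ * cos ω := by fun_prop
  simpa using (this.tendsto 0).mono_left nhdsWithin_le_nhds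

theorem tendsto_mul_sqrt (ρ ω : ℝ) :
    Tendsto (fun τ : ℝ => ρ * √((1 + τ * cos ω) ^ 2 + (τ * sin ω) ^ 2)) (𝓝[>] 0) (𝓝 ρ) := by
  have : Continuous fun τ : ℝ => ρ * √((1 + τ * cos ω) ^ 2 + (τ * sin ω) ^ 2) := by fun_prop
  simpa using (this.tendsto 0).mono_left nhdsWithin_le_nhds

/-- Scale the vertex to `1`. Just outside the unit circle the curve follows the line `Re = 1`, on
the side chosen by `s`. A point `x + iy` with `x > 1` satisfies `|y| < √(x ^ 2 + y ^ 2 - 1)`, so it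
is angularly closer to the real axis than the curve at the same radius. -/
theorem eventually_arg_of_cos_pos {s ρ : ℝ} (hs : s = 1 ∨ s = -1) (hρ : 0 < ρ) {G : ℝ → ℝ}
    (hG : ∀ᶠ r in 𝓝[>] ρ, s * G r = -arctan √(r ^ 2 / ρ ^ 2 - 1)) {ω : ℝ} (hω : 0 < cos ω) :
    ∀ᶠ τ : ℝ in 𝓝[>] 0,
      0 < s * (Complex.arg (1 + τ * Complex.exp ((s * ω : ℝ) * Complex.I)) -
        G (ρ * ‖(1 + τ * Complex.exp ((s * ω : ℝ) * Complex.I) : ℂ)‖)) := by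
  have h1 : Tendsto (fun τ : ℝ => ρ * √((1 + τ * cos ω) ^ 2 + (τ * sin ω) ^ 2)) (𝓝[>] 0)
      (𝓝[>] ρ) := by
    refine tendsto_nhdsWithin_iff.2 ⟨tendsto_mul_sqrt ρ ω, ?_⟩
    filter_upwards [self_mem_nhdsWithin] with τ (hτ : 0 < τ)
    refine lt_mul_of_one_lt_right hρ ?_
    rw [Real.lt_sqrt (by norm_num)]
    nlinarith [sq_nonneg (τ * sin ω), mul_pos hτ hω]
  filter_upwards [h1.eventually hG, self_mem_nhdsWithin] with τ h2 (hτ : 0 < τ)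
  have h3 := mul_pos hτ hω
  rw [one_add_mul_exp_eq _ _ _ hs, mul_sub, sign_mul_arg_mk _ _ _ (by linarith) hs,
    norm_mk_sign_mul _ _ _ hs, h2, sub_neg_eq_add]
  rw [mul_pow, Real.sq_sqrt (by positivity), mul_div_cancel_left₀ _ (by positivity)]
  set x := 1 + τ * cos ω
  set y := τ * sin ω
  have hx : 1 < x := by simp only [x]; linarith
  suffices -arctan √(x ^ 2 + y ^ 2 - 1) < arctan (y / x) by linarith
  rw [← Real.arctan_neg]
  refine Real.arctan_strictMono ?_
  rw [lt_div_iff₀ (by linarith)]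
  have h4 : |y| < √(x ^ 2 + y ^ 2 - 1) * x := by
    have h5 : |y| ≤ √(x ^ 2 + y ^ 2 - 1) := Real.abs_le_sqrt (by nlinarith)
    have h6 : 0 < √(x ^ 2 + y ^ 2 - 1) := Real.sqrt_pos.2 (by nlinarith [sq_nonneg y])
    nlinarith
  have := neg_abs_le y
  linarith

/-- Slightly inward directions: the radius drops by at most `2ρτ|cos ω|`, so the curve's angle
changes by at most `2Cρτ|cos ω|`, while the point itself gains at least `τ sin ω / 2`. The
hypothesis `hCω` compares these two. -/
theorem eventually_arg_of_cos_neg {s ρ C : ℝ} (hs : s = 1 ∨ s = -1) (hρ : 0 < ρ) (hC : 0 ≤ C)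
    {G : ℝ → ℝ} (hG : ∀ᶠ r in 𝓝[<] ρ, |G r| ≤ C * (ρ - r)) {ω : ℝ} (hω : cos ω < 0)
    (hω' : 0 < sin ω) (hCω : 0 < sin ω + 4 * (C * ρ) * cos ω) :
    ∀ᶠ τ : ℝ in 𝓝[>] 0,
      0 < s * (Complex.arg (1 + τ * Complex.exp ((s * ω : ℝ) * Complex.I)) -
        G (ρ * ‖(1 + τ * Complex.exp ((s * ω : ℝ) * Complex.I) : ℂ)‖)) := by
  have h0 : ∀ᶠ τ : ℝ in 𝓝[>] 0, τ < -(2 * cos ω) := by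
    refine (eventually_lt_nhds ?_).filter_mono nhdsWithin_le_nhds
    linarith
  have hlt : ∀ τ : ℝ, 0 < τ → τ < -(2 * cos ω) →
      √((1 + τ * cos ω) ^ 2 + (τ * sin ω) ^ 2) < 1 := by
    intro τ h1 h2
    rw [Real.sqrt_lt' one_pos]
    have := Real.sin_sq_add_cos_sq ω
    have h3 : (1 + τ * cos ω) ^ 2 + (τ * sin ω) ^ 2 = 1 + τ * (2 * cos ω + τ) := by
      linear_combination τ ^ 2 * this
    rw [h3]
    nlinarith
  have h1 : Tendsto (fun τ : ℝ => ρ * √((1 + τ * cos ω) ^ 2 + (τ * sin ω) ^ 2)) (𝓝[>] 0)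
      (𝓝[<] ρ) := by
    refine tendsto_nhdsWithin_iff.2 ⟨tendsto_mul_sqrt ρ ω, ?_⟩
    filter_upwards [self_mem_nhdsWithin, h0] with τ (hτ : 0 < τ) h2
    exact mul_lt_of_lt_one_right hρ (hlt τ hτ h2)
  filter_upwards [h1.eventually hG, self_mem_nhdsWithin, h0,
    (tendsto_one_add_mul_cos ω).eventually (eventually_gt_nhds one_pos),
    (eventually_lt_nhds one_pos).filter_mono nhdsWithin_le_nhds] with τ h2 (hτ : 0 < τ) h3 h4 h5
  have h6 := hlt τ hτ h3
  rw [one_add_mul_exp_eq _ _ _ hs, mul_sub, sign_mul_arg_mk _ _ _ h4 hs,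
    norm_mk_sign_mul _ _ _ hs]
  set x := 1 + τ * cos ω with hx
  set y := τ * sin ω with hy
  set r := √(x ^ 2 + y ^ 2)
  have hr : 1 - r ≤ -(2 * τ * cos ω) := by
    have h7 : r ^ 2 = x ^ 2 + y ^ 2 := Real.sq_sqrt (by positivity)
    have h8 : 0 ≤ r := Real.sqrt_nonneg _
    have h9 : x ^ 2 + y ^ 2 ≥ 1 + 2 * τ * cos ω := by
      nlinarith [sq_nonneg y, sq_nonneg (τ * cos ω)]
    nlinarith
  have hy0 : 0 < y := mul_pos hτ hω'
  have hy1 : y ≤ 1 := by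
    have := Real.sin_le_one ω
    nlinarith
  have h10 : y / 2 ≤ arctan (y / x) := by
    have h11 : y ≤ y / x := by
      rw [le_div_iff₀ h4]
      have : x ≤ 1 := by simp only [hx]; nlinarith
      nlinarith
    refine le_trans ?_ ((div_sqrt_one_add_sq_le_arctan hy0.le).trans
      (Real.arctan_strictMono.monotone h11))
    have h12 : √(1 + y ^ 2) ≤ 2 := by
      rw [Real.sqrt_le_left (by norm_num)]
      nlinarith
    gcongr
  have h13 : s * G (ρ * r) ≤ |G (ρ * r)| := by
    rcases hs with rfl | rfl
    · simpa using le_abs_self _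
    · simpa using neg_le_abs _
  have h14 : C * (ρ - ρ * r) ≤ C * ρ * (-(2 * τ * cos ω)) := by
    rw [show C * (ρ - ρ * r) = C * ρ * (1 - r) by ring]
    gcongr
  have h15 : C * ρ * (-(2 * τ * cos ω)) < y / 2 := by
    rw [hy]
    nlinarith [mul_pos hτ hCω]
  linarith

/-- A radially parametrised curve that turns away from a region at a point `v` leaves a sector of
angle more than `π` for the region. -/
theorem pi_lt_volume_directions {s ρ ψ C : ℝ} (hs : s = 1 ∨ s = -1) (hρ : 0 < ρ) (hC : 0 ≤ C)
    {c v : ℂ} (hv : v = ρ * Complex.exp (ψ * Complex.I)) {U : Set ℂ} {G : ℝ → ℝ}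
    (hG : ∀ᶠ r in 𝓝[>] ρ, s * G r = -arctan √(r ^ 2 / ρ ^ 2 - 1))
    (hG' : ∀ᶠ r in 𝓝[<] ρ, |G r| ≤ C * (ρ - r))
    (hU : ∀ᶠ z in 𝓝 v, 0 < s * (Complex.arg (z / v) - G ‖z‖) → c + z ∈ U) :
    π < volume.real {θ ∈ Ioc (-π) π |
      ∀ᶠ t : ℝ in 𝓝[>] 0, c + v + t * Complex.exp (θ * Complex.I) ∈ U} := by
  -- At `ω = π / 2` the expression equals `1`, so it stays positive a little further; these extra
  -- `δ` radians push the total beyond `π`. The direction `π / 2` itself falls under neither case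
  -- and has measure zero.
  obtain ⟨δ, hδ0, hδ1, hδ⟩ : ∃ δ > 0, δ < π / 2 ∧ ∀ ω ∈ Ioo (π / 2) (π / 2 + δ),
      0 < sin ω + 4 * (C * ρ) * cos ω := by
    have hc : Continuous fun ω => sin ω + 4 * (C * ρ) * cos ω := by fun_prop
    have h1 : ∀ᶠ ω in 𝓝 (π / 2), 0 < sin ω + 4 * (C * ρ) * cos ω :=
      (hc.tendsto _).eventually (eventually_gt_nhds (by simp))
    obtain ⟨ε, hε, h2⟩ := Metric.eventually_nhds_iff.1 h1
    refine ⟨min ε (π / 3), by positivity, (min_le_right _ _).trans_lt (by linarith [pi_pos]),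
      fun ω hω => h2 ?_⟩
    rw [Real.dist_eq, abs_of_pos (by linarith [hω.1])]
    have := min_le_left ε (π / 3)
    linarith [hω.2]
  have hdir : ∀ ω ∈ Ioo (-(π / 2)) (π / 2 + δ) \ {π / 2}, ∀ᶠ τ : ℝ in 𝓝[>] 0,
      0 < s * (Complex.arg (1 + τ * Complex.exp ((s * ω : ℝ) * Complex.I)) -
        G (ρ * ‖(1 + τ * Complex.exp ((s * ω : ℝ) * Complex.I) : ℂ)‖)) := by
    rintro ω ⟨hω, hne⟩
    rcases lt_or_gt_of_ne hne with h1 | h1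
    · exact eventually_arg_of_cos_pos hs hρ hG (Real.cos_pos_of_mem_Ioo ⟨hω.1, h1⟩)
    · refine eventually_arg_of_cos_neg hs hρ hC hG'
        (Real.cos_neg_of_pi_div_two_lt_of_lt h1 (by linarith [hω.2])) ?_ (hδ ω ⟨h1, hω.2⟩)
      exact Real.sin_pos_of_pos_of_lt_pi (by linarith [pi_pos]) (by linarith [hω.2])
  let T : Set ℝ := (fun x => s * (x - ψ)) ⁻¹' (Ioo (-(π / 2)) (π / 2 + δ) \ {π / 2})
  have hs2 : s * s = 1 := by rcases hs with rfl | rfl <;> norm_num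
  have hv0 : v ≠ 0 := by
    rw [hv]
    exact mul_ne_zero (by exact_mod_cast hρ.ne') (Complex.exp_ne_zero _)
  have hTm : MeasurableSet T :=
    (measurableSet_Ioo.diff (measurableSet_singleton _)).preimage (by fun_prop)
  have hTsub : ∃ a, T ⊆ Ioc a (a + 2 * π) := by
    rcases hs with rfl | rfl
    · refine ⟨ψ - π / 2, ?_⟩
      rintro x ⟨hx, -⟩
      rw [mem_Ioo] at hx
      constructor <;> linarith
    · refine ⟨ψ - π / 2 - δ, ?_⟩
      rintro x ⟨hx, -⟩
      rw [mem_Ioo] at hx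
      constructor <;> linarith
  have hTvol : volume T = ENNReal.ofReal (π + δ) := by
    have h1 : MeasurePreserving (fun x => s * (x - ψ)) volume volume := by
      rcases hs with rfl | rfl
      · simpa using measurePreserving_sub_right volume ψ
      · simpa using (volume.measurePreserving_sub_left ψ)
    rw [h1.measure_preimage
      (measurableSet_Ioo.diff (measurableSet_singleton _)).nullMeasurableSet,
      measure_sdiff_null (measure_singleton _), Real.volume_Ioo]
    congr 1
    ring
  obtain ⟨a, ha⟩ := hTsub
  have hle := volume_le_of_forall_add_int_mul
    (S := {θ ∈ Ioc (-π) π | ∀ᶠ t : ℝ in 𝓝[>] 0, c + v + t * Complex.exp (θ * Complex.I) ∈ U})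
    hTm ha (by
      intro θ hθ k hk
      refine ⟨hθ, ?_⟩
      have h1 := hdir _ hk
      have h2 : Complex.exp ((s * (s * (θ + k * (2 * π) - ψ)) : ℝ) * Complex.I) =
          Complex.exp (θ * Complex.I) / Complex.exp (ψ * Complex.I) := by
        rw [← mul_assoc s, hs2, one_mul, ← Complex.exp_sub, Complex.exp_eq_exp_iff_exists_int]
        refine ⟨k, ?_⟩
        push_cast
        ring
      rw [h2] at h1
      have h3 : Tendsto (fun t : ℝ => t / ρ) (𝓝[>] 0) (𝓝[>] 0) := by
        refine tendsto_nhdsWithin_iff.2 ⟨?_, ?_⟩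
        · have : Continuous fun t : ℝ => t / ρ := by fun_prop
          simpa using (this.tendsto 0).mono_left nhdsWithin_le_nhds
        · filter_upwards [self_mem_nhdsWithin] with t (ht : 0 < t)
          exact div_pos ht hρ
      have h4 : Tendsto (fun t : ℝ => v + t * Complex.exp (θ * Complex.I)) (𝓝[>] 0) (𝓝 v) := by
        have : Continuous fun t : ℝ => v + t * Complex.exp (θ * Complex.I) := by fun_prop
        simpa using (this.tendsto 0).mono_left nhdsWithin_le_nhds
      filter_upwards [h3.eventually h1, h4.eventually hU] with t h5 h6
      rw [add_assoc]
      apply h6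
      have hρ' : (ρ : ℂ) ≠ 0 := by exact_mod_cast hρ.ne'
      have h7 : (v + t * Complex.exp (θ * Complex.I)) / v =
          1 + ((t / ρ : ℝ) : ℂ) * (Complex.exp (θ * Complex.I) / Complex.exp (ψ * Complex.I)) := by
        have := Complex.exp_ne_zero (ψ * Complex.I)
        rw [add_div, div_self hv0, hv]
        push_cast
        field_simp
      have h8 : ‖v + t * Complex.exp (θ * Complex.I)‖ =
          ρ * ‖(v + t * Complex.exp (θ * Complex.I)) / v‖ := by
        have : ‖v‖ = ρ := by
          rw [hv, norm_mul, Complex.norm_exp_ofReal_mul_I, mul_one, Complex.norm_real,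
            norm_of_nonneg hρ.le]
        rw [norm_div, this]
        field_simp
      rw [h8, h7]
      exact h5)
  rw [hTvol] at hle
  have hfin : volume {θ ∈ Ioc (-π) π |
      ∀ᶠ t : ℝ in 𝓝[>] 0, c + v + t * Complex.exp (θ * Complex.I) ∈ U} ≠ ⊤ :=
    ((measure_mono (sep_subset _ _)).trans_lt measure_Ioc_lt_top).ne
  have := (ENNReal.ofReal_le_iff_le_toReal hfin).1 hle
  exact lt_of_lt_of_le (by linarith) this

namespace IsSpiral

variable {q : ℕ → ℂ} {t : ℕ → ℝ} {n : ℕ}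

/-- Only a bound from the left holds: terms with `i ≥ j` vanish there and those with `i < j` are
Lipschitz near `‖q j‖`, but just beyond `‖q j‖` the term `j` grows like a square root. -/
theorem sweep_sub_isBigO (h : IsSpiral q t n) {j : ℕ} (h1 : 1 ≤ j) (hj : j ≤ n) :
    (fun r => sweep q t n r - sweep q t n ‖q j‖) =O[𝓝[<] ‖q j‖] fun r => r - ‖q j‖ := by
  have hjpos := h.norm_pos h1 hj
  simp only [sweep, ← Finset.sum_sub_distrib]
  refine Asymptotics.IsBigO.fun_sum fun i hi => ?_
  rw [Finset.mem_Ico] at hi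
  have hipos := h.norm_pos hi.1 hi.2.le
  rcases le_or_gt j i with hji | hij
  · refine Asymptotics.IsBigO.congr' (Asymptotics.isBigO_zero (fun r : ℝ => r - ‖q j‖) _) ?_
      EventuallyEq.rfl
    have h0 : ∀ᶠ r : ℝ in 𝓝[<] ‖q j‖, 0 < r :=
      (eventually_gt_nhds hjpos).filter_mono nhdsWithin_le_nhds
    filter_upwards [h0, self_mem_nhdsWithin] with r h2 (h3 : r < ‖q j‖)
    have h4 := h.norm_mono hji hi.2.le
    rw [sweep_term_eq_of_le_norm h2.le (h3.le.trans h4), sweep_term_eq_of_le_norm hjpos.le h4,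
      sub_zero]
  · have h2 := h.norm_strictMono hij hj
    let g : ℝ → ℝ := fun r => √(r ^ 2 - ‖q i‖ ^ 2) / (‖q i‖ * |t i|)
    have hg : DifferentiableAt ℝ g ‖q j‖ := by
      have : ‖q j‖ ^ 2 - ‖q i‖ ^ 2 ≠ 0 := by nlinarith
      have h3 : DifferentiableAt ℝ (fun r : ℝ => r ^ 2 - ‖q i‖ ^ 2) ‖q j‖ := by fun_prop
      exact (h3.sqrt this).div_const _
    have hm : (fun r => min 1 (g r) - min 1 (g ‖q j‖)) =O[𝓝[<] ‖q j‖] fun r => r - ‖q j‖ := by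
      refine Asymptotics.IsBigO.trans (Asymptotics.isBigO_of_le _ fun r => ?_)
        (hg.isBigO_sub.mono nhdsWithin_le_nhds)
      refine (abs_min_sub_min_le_max 1 (g r) 1 (g ‖q j‖)).trans ?_
      simp
    have ha : DifferentiableAt ℝ (fun x => arctan (t i * x)) (min 1 (g ‖q j‖)) :=
      (differentiableAt_id.const_mul (t i)).arctan
    have ht : Tendsto (fun r => min 1 (g r)) (𝓝[<] ‖q j‖) (𝓝 (min 1 (g ‖q j‖))) := by
      have : Continuous fun r => min 1 (g r) := by fun_prop
      exact (this.tendsto _).mono_left nhdsWithin_le_nhds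
    exact (ha.isBigO_sub.comp_tendsto ht).trans hm

theorem exists_abs_sweep_sub_le (h : IsSpiral q t n) {j : ℕ} (h1 : 1 ≤ j) (hj : j ≤ n) :
    ∃ C, 0 ≤ C ∧ ∀ᶠ r in 𝓝[<] ‖q j‖,
      |sweep q t n r - sweep q t n ‖q j‖| ≤ C * (‖q j‖ - r) := by
  obtain ⟨C, hC, h2⟩ := (h.sweep_sub_isBigO h1 hj).exists_nonneg
  refine ⟨C, hC, ?_⟩
  filter_upwards [h2.bound, self_mem_nhdsWithin] with r h3 (h4 : r < ‖q j‖)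
  rw [Real.norm_eq_abs, Real.norm_eq_abs, abs_of_neg (sub_neg.2 h4)] at h3
  linarith

theorem sweep_vertex (h : IsSpiral q t n) {j : ℕ} (h1 : 1 ≤ j) (hj : j < n) :
    sweep q t n ‖q j‖ = ∑ i ∈ Finset.Ico 1 j, arctan (t i) := by
  rw [h.sweep_eq h1 hj le_rfl (h.norm_lt_succ hj).le]
  simp

theorem sign_mul_sweep_sub (h : IsSpiral q t n) {j : ℕ} (h1 : 1 ≤ j) (hj : j < n) {s : ℝ}
    (hs : s = 1 ∨ s = -1) (hst : s * t j < 0) :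
    ∀ᶠ r in 𝓝[>] ‖q j‖, s * (sweep q t n r - sweep q t n ‖q j‖) =
      -arctan √(r ^ 2 / ‖q j‖ ^ 2 - 1) := by
  have hjpos := h.norm_pos h1 hj.le
  have htj := h.slope_ne j h1 hj
  have h0 : ∀ᶠ r : ℝ in 𝓝[>] ‖q j‖, r < ‖q (j + 1)‖ :=
    (eventually_lt_nhds (h.norm_lt_succ hj)).filter_mono nhdsWithin_le_nhds
  filter_upwards [h0, self_mem_nhdsWithin] with r h2 (h3 : ‖q j‖ < r)
  have h0 : 0 ≤ r := hjpos.le.trans h3.le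
  rw [h.sweep_vertex h1 hj, h.sweep_eq h1 hj h3.le h2.le, add_sub_cancel_left]
  have h4 : √(r ^ 2 - ‖q j‖ ^ 2) = ‖q j‖ * √(r ^ 2 / ‖q j‖ ^ 2 - 1) := by
    rw [show r ^ 2 - ‖q j‖ ^ 2 = ‖q j‖ ^ 2 * (r ^ 2 / ‖q j‖ ^ 2 - 1) by field_simp,
      Real.sqrt_mul (by positivity), Real.sqrt_sq hjpos.le]
  have h5 : √(r ^ 2 - ‖q j‖ ^ 2) ≤ ‖q j‖ * |t j| := by
    rw [Real.sqrt_le_left (by positivity)]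
    have : r ^ 2 ≤ ‖q (j + 1)‖ ^ 2 := by gcongr
    rw [h.norm_succ h1 hj, mul_pow, Real.sq_sqrt (by positivity)] at this
    rw [mul_pow, sq_abs]
    linarith
  rw [min_eq_right ((div_le_one (by positivity)).2 h5), h4, mul_div_mul_left _ _ hjpos.ne']
  rcases hs with rfl | rfl
  · rw [abs_of_neg (by linarith), div_neg, mul_neg, mul_div_cancel₀ _ htj, arctan_neg, one_mul]
  · rw [abs_of_pos (by linarith), mul_div_cancel₀ _ htj, neg_one_mul]

/-- At a vertex where a spiral turns away from a region, the region has an angle of more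
than `π`. -/
theorem pi_lt_volume_directions (h : IsSpiral q t n) {α : ℝ}
    (hα : q 1 = ‖q 1‖ * Complex.exp (α * Complex.I)) {j : ℕ} (h1 : 1 ≤ j) (hj : j < n) {s : ℝ}
    (hs : s = 1 ∨ s = -1) (hst : s * t j < 0) {c : ℂ} {U : Set ℂ}
    (hU : ∀ᶠ z in 𝓝 (q j), ∀ φ : ℝ, φ = α + sweep q t n ‖q j‖ + Complex.arg (z / q j) →
      z = ‖z‖ * Complex.exp (φ * Complex.I) → 0 < s * (φ - (α + sweep q t n ‖z‖)) → c + z ∈ U) :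
    π < volume.real {θ ∈ Ioc (-π) π |
      ∀ᶠ τ : ℝ in 𝓝[>] 0, c + q j + τ * Complex.exp (θ * Complex.I) ∈ U} := by
  obtain ⟨C, hC, h2⟩ := h.exists_abs_sweep_sub_le h1 hj.le
  have hv := h.vertex_eq hα h1 hj.le
  rw [← h.sweep_vertex h1 hj] at hv
  have hjpos := h.norm_pos h1 hj.le
  refine _root_.pi_lt_volume_directions hs hjpos hC hv
    (G := fun r => sweep q t n r - sweep q t n ‖q j‖) (h.sign_mul_sweep_sub h1 hj hs hst) h2 ?_
  filter_upwards [hU] with z hz h3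
  refine hz _ rfl ?_ ?_
  · have hj0 : q j ≠ 0 := norm_pos_iff.1 hjpos
    have h4 : z = q j * (z / q j) := by field_simp
    have h5 : z / q j = ‖z / q j‖ * Complex.exp (Complex.arg (z / q j) * Complex.I) :=
      (Complex.norm_mul_exp_arg_mul_I _).symm
    nth_rw 1 [h4, h5, hv]
    rw [norm_div]
    have h6 : (‖q j‖ : ℂ) ≠ 0 := by exact_mod_cast hjpos.ne'
    push_cast
    rw [add_mul _ (Complex.arg _ : ℂ), Complex.exp_add]
    field_simp
  · convert h3 using 2
    ring

end IsSpiral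

/-! ### Convex polygons have no angle greater than `π`. -/

/-- An open half-plane through the origin contains directions of total measure at most `π`. -/
theorem volume_halfPlane_directions_le (a b : ℝ) :
    volume.real {θ ∈ Ioc (-π) π | a * cos θ + b * sin θ < 0} ≤ π := by
  let S : Set ℝ := {θ | a * cos θ + b * sin θ < 0}
  have hS : IsOpen S := isOpen_lt (by fun_prop) continuous_const
  -- Adding `π` to `θ` changes the sign of the linear form.
  have h1 : volume (S ∩ Ioc 0 π) ≤ volume (Ioc (-π) 0 \ S) := by
    have h2 : MeasurePreserving (fun x : ℝ => x + π) volume volume :=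
      measurePreserving_add_right volume π
    rw [← h2.measure_preimage (hS.measurableSet.inter measurableSet_Ioc).nullMeasurableSet]
    refine measure_mono ?_
    rintro θ ⟨h3, h4⟩
    simp only [S, mem_ofPred_eq, Real.cos_add_pi, Real.sin_add_pi] at h3
    refine ⟨⟨by linarith [h4.1], by linarith [h4.2]⟩, ?_⟩
    simp only [S, mem_ofPred_eq]
    linarith
  have h2 : volume (S ∩ Ioc (-π) π) ≤ ENNReal.ofReal π := by
    calc volume (S ∩ Ioc (-π) π) ≤ volume (S ∩ Ioc (-π) 0) + volume (S ∩ Ioc 0 π) := by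
          refine (measure_mono ?_).trans (measure_union_le _ _)
          rw [← inter_union_distrib_left, Ioc_union_Ioc_eq_Ioc (by linarith [pi_pos]) pi_pos.le]
      _ ≤ volume (Ioc (-π) 0 ∩ S) + volume (Ioc (-π) 0 \ S) := by
          rw [inter_comm S (Ioc (-π) 0)]
          gcongr
      _ = ENNReal.ofReal π := by
          rw [measure_inter_add_sdiff _ hS.measurableSet, Real.volume_Ioc]
          simp
  rw [inter_comm] at h2
  exact ENNReal.toReal_le_of_le_ofReal pi_pos.le h2

namespace Polygon

variable {N : ℕ} (P : Polygon ℂ N)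

theorem isClosed_boundary : IsClosed (P.boundary ℝ) := by
  refine isClosed_iUnion_of_finite fun i => ?_
  rw [edgeSet_eq_image_edgePath]
  refine (isCompact_Icc.image ?_).isClosed
  exact AffineMap.lineMap_continuous

theorem isOpen_inside : IsOpen P.inside := by
  rw [isOpen_iff_forall_mem_open]
  rintro z ⟨hz, hb⟩
  refine ⟨connectedComponentIn (P.boundary ℝ)ᶜ z, fun w hw => ?_,
    P.isClosed_boundary.isOpen_compl.connectedComponentIn, mem_connectedComponentIn hz⟩
  refine ⟨connectedComponentIn_subset _ _ hw, ?_⟩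
  rwa [← connectedComponentIn_eq hw]

theorem vertex_mem_boundary (i : Fin N) : P i ∈ P.boundary ℝ :=
  mem_iUnion.2 ⟨i, 0, ⟨le_rfl, zero_le_one⟩, AffineMap.lineMap_apply_zero _ _⟩

/-- A line through the vertex bounds an open half-plane containing the open convex inside, so every
inward direction points into that half-plane. -/
theorem IsConvex.interiorAngle_le_pi {P : Polygon ℂ N} (h : P.IsConvex) (i : Fin N) :
    P.interiorAngle i ≤ π := by
  obtain ⟨f, hf⟩ := geometric_hahn_banach_open_point h P.isOpen_inside
    (fun hi => hi.1 (P.vertex_mem_boundary i) : P i ∉ P.inside)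
  refine le_trans (measureReal_mono ?_ ?_) (volume_halfPlane_directions_le (f 1) (f Complex.I))
  · rintro θ ⟨hθ, h1⟩
    refine ⟨hθ, ?_⟩
    obtain ⟨t, h2, (h3 : 0 < t)⟩ := (h1.and self_mem_nhdsWithin).exists
    have h4 := hf _ h2
    have h5 : P i + t * Complex.exp (θ * Complex.I) =
        P i + t • (cos θ • (1 : ℂ) + sin θ • Complex.I) := by
      rw [Complex.exp_mul_I]
      simp [mul_add]
    rw [h5, map_add, map_smul, map_add, map_smul, map_smul] at h4
    simp only [smul_eq_mul] at h4
    by_contra! h6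
    nlinarith [mul_nonneg h3.le h6]
  · exact ((measure_mono (sep_subset _ _)).trans_lt measure_Ioc_lt_top).ne

theorem IsConvex.reflexCount_eq_zero {P : Polygon ℂ N} (h : P.IsConvex) : P.reflexCount = 0 := by
  rw [reflexCount, Set.ncard_eq_zero]
  exact eq_empty_of_forall_notMem fun i hi => (h.interiorAngle_le_pi i).not_gt hi

end Polygon

/-! ### Pairs of spirals and their total turning. -/

/-- By the intermediate value theorem `D` stays in one gap of `2πℤ`, which must be adjacent to its
end value `0`. -/
theorem forall_mem_Ioo_or_of_ne_int_mul {D : ℝ → ℝ} {R : ℝ} (hD : Continuous D) (hR : D R = 0)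
    (hne : ∀ r ∈ Ioo 0 R, ∀ k : ℤ, D r ≠ k * (2 * π)) :
    (∀ r ∈ Ioo 0 R, 0 < D r ∧ D r < 2 * π) ∨ (∀ r ∈ Ioo 0 R, -(2 * π) < D r ∧ D r < 0) := by
  have hp := Real.two_pi_pos
  have hlt : ∀ r ∈ Ioo 0 R, D r < 2 * π := by
    intro r hr
    by_contra! h
    obtain ⟨x, hx, hx'⟩ := intermediate_value_Icc' hr.2.le hD.continuousOn
      (⟨by rw [hR]; exact hp.le, h⟩ : 2 * π ∈ Icc (D R) (D r))
    have hxR : x ≠ R := by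
      rintro rfl
      linarith
    exact hne x ⟨hr.1.trans_le hx.1, lt_of_le_of_ne hx.2 hxR⟩ 1 (by simpa using hx')
  have hgt : ∀ r ∈ Ioo 0 R, -(2 * π) < D r := by
    intro r hr
    by_contra! h
    obtain ⟨x, hx, hx'⟩ := intermediate_value_Icc hr.2.le hD.continuousOn
      (⟨h, by rw [hR]; linarith⟩ : -(2 * π) ∈ Icc (D r) (D R))
    have hxR : x ≠ R := by
      rintro rfl
      linarith
    exact hne x ⟨hr.1.trans_le hx.1, lt_of_le_of_ne hx.2 hxR⟩ (-1) (by simpa using hx')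
  by_cases hpos : ∀ r ∈ Ioo 0 R, 0 < D r
  · exact Or.inl fun r hr => ⟨hpos r hr, hlt r hr⟩
  · right
    push Not at hpos
    obtain ⟨r₀, hr₀, h0⟩ := hpos
    intro r hr
    refine ⟨hgt r hr, ?_⟩
    by_contra! h1
    obtain ⟨x, hx, hx'⟩ := intermediate_value_uIcc (a := r₀) (b := r) hD.continuousOn
      (Icc_subset_uIcc ⟨h0, h1⟩)
    have hxm : x ∈ Ioo 0 R := ordConnected_Ioo.uIcc_subset hr₀ hr hx
    exact hne x hxm 0 (by simpa using hx')

theorem abs_arctan_le_add (x : ℝ) : |arctan x| ≤ arctan x + if x < 0 then π else 0 := by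
  split_ifs with h
  · rw [abs_of_neg (Real.arctan_lt_zero.2 h)]
    linarith [Real.neg_pi_div_two_lt_arctan x]
  · rw [abs_of_nonneg (Real.arctan_nonneg.2 (not_lt.1 h)), add_zero]

theorem abs_arctan_le_neg_add (x : ℝ) : |arctan x| ≤ -arctan x + if 0 < x then π else 0 := by
  simpa [Real.arctan_neg] using abs_arctan_le_add (-x)

/-- Two spirals with a common end point, the second one running ahead of the first one by an angle
between `0` and `2π`, which together make up a closed curve `c + K`. -/
structure IsSpiralPair (q : ℕ → ℂ) (t : ℕ → ℝ) (n : ℕ) (q' : ℕ → ℂ) (t' : ℕ → ℝ) (n' : ℕ)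
    (α α' : ℝ) (c : ℂ) (K : Set ℂ) : Prop where
  lower : IsSpiral q t n
  upper : IsSpiral q' t' n'
  lower_one : q 1 = ‖q 1‖ * Complex.exp (α * Complex.I)
  upper_one : q' 1 = ‖q' 1‖ * Complex.exp (α' * Complex.I)
  norm_end : ‖q n‖ = ‖q' n'‖
  sweep_end : α + sweep q t n ‖q n‖ = α' + sweep q' t' n' ‖q n‖
  lt : ∀ r ∈ Ioo 0 ‖q n‖, α + sweep q t n r < α' + sweep q' t' n' r
  lt_add : ∀ r ∈ Ioo 0 ‖q n‖, α' + sweep q' t' n' r < α + sweep q t n r + 2 * π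
  mem_iff : ∀ z, z ∈ K ↔
    (∃ j < n, ∃ s ∈ Icc (0 : ℝ) 1, z = c + AffineMap.lineMap (q j) (q (j + 1)) s) ∨
    (∃ j < n', ∃ s ∈ Icc (0 : ℝ) 1, z = c + AffineMap.lineMap (q' j) (q' (j + 1)) s)

namespace IsSpiral

variable {q : ℕ → ℂ} {t : ℕ → ℝ} {n : ℕ}

theorem exists_lineMap_eq_of_le (h : IsSpiral q t n) {α : ℝ}
    (hα : q 1 = ‖q 1‖ * Complex.exp (α * Complex.I)) {r : ℝ} (hr : r ∈ Icc 0 ‖q n‖) :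
    ∃ j < n, ∃ s ∈ Icc (0 : ℝ) 1, AffineMap.lineMap (q j) (q (j + 1)) s =
      (r : ℂ) * Complex.exp ((α + sweep q t n r : ℝ) * Complex.I) := by
  rcases hr.2.lt_or_eq with hlt | rfl
  · obtain ⟨j, hj, s, hs, h1⟩ := h.exists_lineMap_eq hα hr.1 hlt
    exact ⟨j, hj, s, ⟨hs.1, hs.2.le⟩, h1⟩
  · have hn := h.pos
    refine ⟨n - 1, by lia, 1, by simp, ?_⟩
    rw [AffineMap.lineMap_apply_one, Nat.sub_add_cancel hn]
    exact h.end_eq hα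

end IsSpiral

namespace IsSpiralPair

variable {q q' : ℕ → ℂ} {t t' : ℕ → ℝ} {n n' : ℕ} {α α' : ℝ} {c : ℂ} {K : Set ℂ}

theorem mem_of_angularRegion (h : IsSpiralPair q t n q' t' n' α α' c K) {z : ℂ}
    (hz : z ∈ angularRegion c (fun r => α + sweep q t n r) (fun r => α' + sweep q' t' n' r) ‖q n‖) :
    z ∉ K ∧ Bornology.IsBounded (connectedComponentIn Kᶜ z) := by
  have hf : Continuous fun r => α + sweep q t n r := (continuous_sweep q t n).const_add α
  have hg : Continuous fun r => α' + sweep q' t' n' r := (continuous_sweep q' t' n').const_add α'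
  have hdisj : Disjoint (angularRegion c (fun r => α + sweep q t n r)
      (fun r => α' + sweep q' t' n' r) ‖q n‖) K := by
    refine disjoint_angularRegion h.lt_add fun z hz => ?_
    rcases (h.mem_iff z).1 hz with ⟨j, hj, s, hs, rfl⟩ | ⟨j, hj, s, hs, rfl⟩
    · left
      rw [add_sub_cancel_left]
      exact congrArg (c + ·) (h.lower.lineMap_eq_norm_mul_exp h.lower_one hj hs rfl)
    · right
      rw [add_sub_cancel_left]
      exact congrArg (c + ·) (h.upper.lineMap_eq_norm_mul_exp h.upper_one hj hs rfl)
  refine ⟨disjoint_left.1 hdisj hz,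
    isBounded_connectedComponentIn_of_mem_angularRegion hf hg h.lt h.sweep_end ?_ ?_ hdisj hz⟩
  · intro r hr
    obtain ⟨j, hj, s, hs, h1⟩ := h.lower.exists_lineMap_eq_of_le h.lower_one hr
    rw [h.mem_iff]
    exact Or.inl ⟨j, hj, s, hs, by rw [h1]⟩
  · intro r hr
    rw [h.norm_end] at hr
    obtain ⟨j, hj, s, hs, h1⟩ := h.upper.exists_lineMap_eq_of_le h.upper_one hr
    rw [h.mem_iff]
    exact Or.inr ⟨j, hj, s, hs, by rw [h1]⟩

/-- The upper spiral is strictly ahead at this radius, so near the vertex only the lower one limits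
the region; there it bends away from the region. -/
theorem pi_lt_volume_lower (h : IsSpiralPair q t n q' t' n' α α' c K) {j : ℕ} (h1 : 1 ≤ j)
    (hj : j < n) (ht : t j < 0) {U : Set ℂ}
    (hU : ∀ z, z ∉ K ∧ Bornology.IsBounded (connectedComponentIn Kᶜ z) → z ∈ U) :
    π < volume.real {θ ∈ Ioc (-π) π |
      ∀ᶠ τ : ℝ in 𝓝[>] 0, c + q j + τ * Complex.exp (θ * Complex.I) ∈ U} := by
  have hjpos := h.lower.norm_pos h1 hj.le
  have hj0 : q j ≠ 0 := norm_pos_iff.1 hjpos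
  have hjn := h.lower.norm_strictMono hj le_rfl
  refine h.lower.pi_lt_volume_directions h.lower_one h1 hj (s := 1) (Or.inl rfl) (by linarith) ?_
  have e1 : ∀ᶠ z in 𝓝 (q j), ‖z‖ ∈ Ioo 0 ‖q n‖ :=
    (continuous_norm.tendsto (q j)).eventually (Ioo_mem_nhds hjpos hjn)
  have e2 : ∀ᶠ z in 𝓝 (q j), α + sweep q t n ‖q j‖ + Complex.arg (z / q j) <
      α' + sweep q' t' n' ‖z‖ := by
    have c1 : ContinuousAt (fun z : ℂ => α + sweep q t n ‖q j‖ + Complex.arg (z / q j)) (q j) := by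
      refine continuousAt_const.add (ContinuousAt.comp (g := Complex.arg) ?_ (by fun_prop))
      rw [div_self hj0]
      exact Complex.continuousAt_arg (by simp)
    have c2 : ContinuousAt (fun z : ℂ => α' + sweep q' t' n' ‖z‖) (q j) :=
      (((continuous_sweep q' t' n').comp continuous_norm).const_add α').continuousAt
    refine c1.eventually_lt c2 ?_
    simpa [div_self hj0] using h.lt _ ⟨hjpos, hjn⟩
  filter_upwards [e1, e2] with z h2 h3 φ hφ hz h4
  refine hU _ (h.mem_of_angularRegion ⟨‖z‖, h2, φ, ⟨?_, ?_⟩, congrArg (c + ·) hz⟩)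
  · linarith
  · rwa [hφ]

theorem pi_lt_volume_upper (h : IsSpiralPair q t n q' t' n' α α' c K) {j : ℕ} (h1 : 1 ≤ j)
    (hj : j < n') (ht : 0 < t' j) {U : Set ℂ}
    (hU : ∀ z, z ∉ K ∧ Bornology.IsBounded (connectedComponentIn Kᶜ z) → z ∈ U) :
    π < volume.real {θ ∈ Ioc (-π) π |
      ∀ᶠ τ : ℝ in 𝓝[>] 0, c + q' j + τ * Complex.exp (θ * Complex.I) ∈ U} := by
  have hjpos := h.upper.norm_pos h1 hj.le
  have hj0 : q' j ≠ 0 := norm_pos_iff.1 hjpos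
  have hjn := h.upper.norm_strictMono hj le_rfl
  rw [← h.norm_end] at hjn
  refine h.upper.pi_lt_volume_directions h.upper_one h1 hj (s := -1) (Or.inr rfl) (by linarith) ?_
  have e1 : ∀ᶠ z in 𝓝 (q' j), ‖z‖ ∈ Ioo 0 ‖q n‖ :=
    (continuous_norm.tendsto (q' j)).eventually (Ioo_mem_nhds hjpos hjn)
  have e2 : ∀ᶠ z in 𝓝 (q' j), α + sweep q t n ‖z‖ <
      α' + sweep q' t' n' ‖q' j‖ + Complex.arg (z / q' j) := by
    have c1 : ContinuousAt (fun z : ℂ => α' + sweep q' t' n' ‖q' j‖ + Complex.arg (z / q' j))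
        (q' j) := by
      refine continuousAt_const.add (ContinuousAt.comp (g := Complex.arg) ?_ (by fun_prop))
      rw [div_self hj0]
      exact Complex.continuousAt_arg (by simp)
    have c2 : ContinuousAt (fun z : ℂ => α + sweep q t n ‖z‖) (q' j) :=
      (((continuous_sweep q t n).comp continuous_norm).const_add α).continuousAt
    refine c2.eventually_lt c1 ?_
    simpa [div_self hj0] using h.lt _ ⟨hjpos, hjn⟩
  filter_upwards [e1, e2] with z h2 h3 φ hφ hz h4
  refine hU _ (h.mem_of_angularRegion ⟨‖z‖, h2, φ, ⟨?_, ?_⟩, congrArg (c + ·) hz⟩)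
  · rwa [hφ]
  · linarith

theorem sum_abs_arctan_le (h : IsSpiralPair q t n q' t' n' α α' c K) :
    ∑ j ∈ Finset.Ico 1 n, |arctan (t j)| + ∑ j ∈ Finset.Ico 1 n', |arctan (t' j)| ≤
      2 * π + π * (({j ∈ Finset.Ico 1 n | t j < 0}.card : ℝ) +
        ({j ∈ Finset.Ico 1 n' | 0 < t' j}.card : ℝ)) := by
  have h1 : ∑ j ∈ Finset.Ico 1 n, |arctan (t j)| ≤ ∑ j ∈ Finset.Ico 1 n, arctan (t j) +
      π * ({j ∈ Finset.Ico 1 n | t j < 0}.card : ℝ) := by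
    refine (Finset.sum_le_sum fun j _ => abs_arctan_le_add (t j)).trans ?_
    rw [Finset.sum_add_distrib, ← Finset.sum_filter, Finset.sum_const, nsmul_eq_mul, mul_comm π]
  have h2 : ∑ j ∈ Finset.Ico 1 n', |arctan (t' j)| ≤ -∑ j ∈ Finset.Ico 1 n', arctan (t' j) +
      π * ({j ∈ Finset.Ico 1 n' | 0 < t' j}.card : ℝ) := by
    refine (Finset.sum_le_sum fun j _ => abs_arctan_le_neg_add (t' j)).trans ?_
    rw [Finset.sum_add_distrib, ← Finset.sum_filter, Finset.sum_const, nsmul_eq_mul, mul_comm π,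
      Finset.sum_neg_distrib]
  have h3 := h.sweep_end
  rw [h.lower.sweep_norm_end, h.norm_end, h.upper.sweep_norm_end] at h3
  have p1 := h.lower.norm_pos le_rfl h.lower.pos
  have p2 := h.upper.norm_pos le_rfl h.upper.pos
  -- At a radius below both first vertices nothing has been swept, so `lt_add` reads `α' < α + 2 *
  -- π`.
  have h4 : min ‖q 1‖ ‖q' 1‖ / 2 ∈ Ioo 0 ‖q n‖ := by
    have := h.lower.norm_mono h.lower.pos le_rfl
    have := min_le_left ‖q 1‖ ‖q' 1‖
    have : 0 < min ‖q 1‖ ‖q' 1‖ := lt_min p1 p2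
    constructor <;> linarith
  have h5 := h.lt_add _ h4
  rw [h.lower.sweep_eq_zero h4.1.le, h.upper.sweep_eq_zero h4.1.le] at h5
  · linarith
  · have := min_le_right ‖q 1‖ ‖q' 1‖
    linarith [h4.1]
  · have := min_le_left ‖q 1‖ ‖q' 1‖
    linarith [h4.1]

end IsSpiralPair

/-! ### From an arithmetic polygon to two spirals. -/

theorem exists_eq_mul_I_mul_of_inner_eq_zero {u w : ℂ} (hu : u ≠ 0) (h : inner ℝ u w = 0) :
    w = u * ((w / u).im * Complex.I) := by
  have h1 : (w / u).re = 0 := by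
    rw [Complex.div_re, ← add_div]
    rw [Complex.inner] at h
    simp only [Complex.mul_re, Complex.conj_re, Complex.conj_im] at h
    rw [show w.re * u.re + w.im * u.im = 0 by linarith, zero_div]
  have h2 : w / u = (w / u).im * Complex.I := by
    apply Complex.ext <;> simp [h1]
  rw [← h2]
  field_simp

theorem eq_mul_one_add_of_inner_eq_zero {u v : ℂ} (hu : u ≠ 0) (h : inner ℝ u (v - u) = 0) :
    v = u * (1 + ((v - u) / u).im * Complex.I) := by
  rw [mul_add, mul_one, ← exists_eq_mul_I_mul_of_inner_eq_zero hu h, add_sub_cancel]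

theorem norm_eq_abs_im_div_of_inner_eq_zero {u w : ℂ} (hu : u ≠ 0) (h : inner ℝ u w = 0) :
    ‖w‖ = ‖u‖ * |(w / u).im| := by
  conv_lhs => rw [exists_eq_mul_I_mul_of_inner_eq_zero hu h]
  simp

/-- Two vectors of the plane that are perpendicular to a third one are parallel. -/
theorem angle_eq_zero_or_pi_of_inner_eq_zero {u v w : ℂ} (hu : u ≠ 0) (hv : v ≠ 0) (hw : w ≠ 0)
    (hv' : inner ℝ u v = 0) (hw' : inner ℝ u w = 0) :
    InnerProductGeometry.angle v w = 0 ∨ InnerProductGeometry.angle v w = π := by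
  have h1 := exists_eq_mul_I_mul_of_inner_eq_zero hu hv'
  have h2 := exists_eq_mul_I_mul_of_inner_eq_zero hu hw'
  set x := (v / u).im
  set y := (w / u).im
  have hx : x ≠ 0 := by rintro h; simp [h] at h1; exact hv h1
  have hy : y ≠ 0 := by rintro h; simp [h] at h2; exact hw h2
  have hx' : (x : ℂ) ≠ 0 := by exact_mod_cast hx
  have h3 : w = (y / x) • v := by
    rw [h1, h2, Complex.real_smul]
    push_cast
    field_simp
  rcases lt_or_gt_of_ne (div_ne_zero hy hx) with h4 | h4
  · right
    exact InnerProductGeometry.angle_eq_pi_iff.2 ⟨hv, _, h4, h3⟩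
  · left
    exact InnerProductGeometry.angle_eq_zero_iff.2 ⟨hv, _, h4, h3⟩

namespace Polygon

variable {N : ℕ} [NeZero N] (P : Polygon ℂ N)

/-- The `k`-th vertex, seen from the vertex `P 0`. -/
def relVertex (k : ℕ) : ℂ := P (Fin.ofNat N k) - P 0

theorem relVertex_zero : P.relVertex 0 = 0 := by simp [relVertex]

theorem relVertex_self : P.relVertex N = 0 := by simp [relVertex]

theorem add_relVertex (k : ℕ) : P 0 + P.relVertex k = P (Fin.ofNat N k) := by simp [relVertex]

theorem finRotate_eq_add_one (i : Fin N) : finRotate N i = i + 1 := by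
  exact finRotate_apply i

theorem ofNat_add_one (k : ℕ) : (Fin.ofNat N k + 1 : Fin N) = Fin.ofNat N (k + 1) := by
  apply Fin.ext
  simp [Fin.val_add, Fin.ofNat]

theorem edgePath_ofNat (k : ℕ) (s : ℝ) : P.edgePath ℝ (Fin.ofNat N k) s =
    P 0 + AffineMap.lineMap (P.relVertex k) (P.relVertex (k + 1)) s := by
  rw [edgePath, finRotate_eq_add_one, ofNat_add_one, ← add_relVertex, ← add_relVertex]
  simp only [AffineMap.lineMap_apply, vsub_eq_sub, vadd_eq_add, add_sub_add_left_eq_sub]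
  ring

theorem mem_boundary_iff (z : ℂ) : z ∈ P.boundary ℝ ↔ ∃ k < N, ∃ s ∈ Icc (0 : ℝ) 1,
    z = P 0 + AffineMap.lineMap (P.relVertex k) (P.relVertex (k + 1)) s := by
  simp only [boundary, mem_iUnion, edgeSet_eq_image_edgePath, mem_image]
  constructor
  · rintro ⟨i, s, hs, rfl⟩
    refine ⟨i, i.2, s, hs, ?_⟩
    rw [← edgePath_ofNat]
    simp
  · rintro ⟨k, -, s, hs, rfl⟩
    exact ⟨Fin.ofNat N k, s, hs, P.edgePath_ofNat k s⟩

variable {P}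

theorem IsSimple.eq_of_lineMap_eq (h : P.IsSimple) {j k : ℕ} (hj : j < N) (hk : k < N) {s t : ℝ}
    (hs : s ∈ Ico (0 : ℝ) 1) (ht : t ∈ Ico (0 : ℝ) 1)
    (heq : (AffineMap.lineMap (P.relVertex j) (P.relVertex (j + 1)) s : ℂ) =
      AffineMap.lineMap (P.relVertex k) (P.relVertex (k + 1)) t) : j = k := by
  have h1 := (h (Fin.ofNat N j) (Fin.ofNat N k) s hs t ht
    (by rw [edgePath_ofNat, edgePath_ofNat, heq])).1
  have h2 := congrArg Fin.val h1
  rwa [Fin.val_ofNat, Fin.val_ofNat, Nat.mod_eq_of_lt hj, Nat.mod_eq_of_lt hk] at h2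

theorem IsSimple.relVertex_ne_zero (h : P.IsSimple) {k : ℕ} (h0 : 1 ≤ k) (hk : k < N) :
    P.relVertex k ≠ 0 := by
  intro h1
  have := h.eq_of_lineMap_eq hk (by lia : 0 < N) (s := 0) (t := 0) (by simp) (by simp)
    (by simp [h1, relVertex_zero])
  lia

theorem IsArithmetic.exists_norm_sub (h : P.IsArithmetic) :
    ∃ a : ℕ, ∀ k < N, ‖P.relVertex (k + 1) - P.relVertex k‖ = (a : ℝ) + 1 + k := by
  obtain ⟨a, ha⟩ := h.sides
  refine ⟨a, fun k hk => ?_⟩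
  have := ha (Fin.ofNat N k)
  rw [ofNat_add_one, dist_comm, dist_eq_norm, Fin.val_ofNat, Nat.mod_eq_of_lt hk] at this
  rw [← this]
  simp [relVertex]

theorem IsArithmetic.inner_eq_zero (h : P.IsArithmetic) (k : ℕ) :
    inner ℝ (P.relVertex k) (P.relVertex (k + 1) - P.relVertex k) = 0 ∨
    inner ℝ (P.relVertex (k + 1)) (P.relVertex (k + 1) - P.relVertex k) = 0 := by
  obtain ⟨l, -, h1, h2, h3⟩ := h.perpendicular (Fin.ofNat N k)
  rw [ofNat_add_one] at h1 h3
  have h4 : P.relVertex (k + 1) - P.relVertex k ∈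
      (affineSpan ℝ {P (Fin.ofNat N k), P (Fin.ofNat N (k + 1))}).direction := by
    have := AffineSubspace.vsub_mem_direction
      (right_mem_affineSpan_pair ℝ (P (Fin.ofNat N k)) (P (Fin.ofNat N (k + 1))))
      (left_mem_affineSpan_pair ℝ (P (Fin.ofNat N k)) (P (Fin.ofNat N (k + 1))))
    simpa [relVertex] using this
  rw [Submodule.isOrtho_iff_inner_eq] at h1
  exact h3.imp (fun h5 => h1 _ (AffineSubspace.vsub_mem_direction h5 h2) _ h4)
    (fun h5 => h1 _ (AffineSubspace.vsub_mem_direction h5 h2) _ h4)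

theorem IsArithmetic.angle_ne (h : P.IsArithmetic) (k : ℕ) :
    InnerProductGeometry.angle (P.relVertex k - P.relVertex (k + 1))
      (P.relVertex (k + 2) - P.relVertex (k + 1)) ≠ 0 ∧
    InnerProductGeometry.angle (P.relVertex k - P.relVertex (k + 1))
      (P.relVertex (k + 2) - P.relVertex (k + 1)) ≠ π := by
  have h1 := h.nondegenerate (Fin.ofNat N (k + 1))
  rw [ofNat_add_one, ← ofNat_add_one k, add_sub_cancel_right, ofNat_add_one,
    EuclideanGeometry.angle] at h1
  simpa [relVertex] using h1

theorem IsArithmetic.relVertex_succ_ne (h : P.IsArithmetic) {k : ℕ} (hk : k < N) :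
    P.relVertex (k + 1) ≠ P.relVertex k := by
  obtain ⟨a, ha⟩ := h.exists_norm_sub
  intro h1
  have := ha k hk
  rw [h1, sub_self, norm_zero] at this
  have : (0 : ℝ) < (a : ℝ) + 1 + k := by positivity
  linarith

/-- Two consecutive sides both perpendicular to the radius at their common vertex would be parallel,
which `nondegenerate` forbids. -/
theorem IsArithmetic.inner_succ_eq_zero (h : P.IsArithmetic) (hs : P.IsSimple) {k : ℕ}
    (hk' : k + 1 < N)
    (h1 : inner ℝ (P.relVertex (k + 1)) (P.relVertex (k + 1) - P.relVertex k) = 0) :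
    inner ℝ (P.relVertex (k + 2)) (P.relVertex (k + 2) - P.relVertex (k + 1)) = 0 := by
  refine (h.inner_eq_zero (k + 1)).resolve_left fun h2 => ?_
  have h3 : inner ℝ (P.relVertex (k + 1)) (P.relVertex k - P.relVertex (k + 1)) = 0 := by
    rw [← neg_sub, inner_neg_right, h1, neg_zero]
  rcases angle_eq_zero_or_pi_of_inner_eq_zero (hs.relVertex_ne_zero (by lia) hk')
    (sub_ne_zero.2 (h.relVertex_succ_ne (by lia)).symm)
    (sub_ne_zero.2 (h.relVertex_succ_ne hk')) h3 h2 with h4 | h4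
  · exact (h.angle_ne k).1 h4
  · exact (h.angle_ne k).2 h4

/-- The polygon first moves away from `P 0` and then comes back. -/
theorem IsArithmetic.exists_turning_vertex (h : P.IsArithmetic) (hs : P.IsSimple) (hN : 2 ≤ N) :
    ∃ m, 1 ≤ m ∧ m < N ∧
      (∀ k, 1 ≤ k → k < m →
        inner ℝ (P.relVertex k) (P.relVertex (k + 1) - P.relVertex k) = 0) ∧
      (∀ k, m ≤ k → k + 1 < N →
        inner ℝ (P.relVertex (k + 1)) (P.relVertex (k + 1) - P.relVertex k) = 0) := by
  classical
  -- The alternative `m = N - 1` makes the search succeed in any case; the radial sides `0` and `N -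
  -- 1` need no perpendicularity condition.
  have hex : ∃ m, 1 ≤ m ∧ (m = N - 1 ∨
      inner ℝ (P.relVertex (m + 1)) (P.relVertex (m + 1) - P.relVertex m) = 0) :=
    ⟨N - 1, by lia, Or.inl rfl⟩
  have h1 := Nat.find_spec hex
  have hle : Nat.find hex ≤ N - 1 := Nat.find_min' hex ⟨by lia, Or.inl rfl⟩
  refine ⟨Nat.find hex, h1.1, by lia, ?_, ?_⟩
  · intro k hk hkm
    have h2 := Nat.find_min hex hkm
    push Not at h2
    exact (h.inner_eq_zero k).resolve_right (h2 hk).2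
  · intro k hk
    induction k, hk using Nat.le_induction with
    | base => exact fun h3 => h1.2.resolve_left (by lia)
    | succ k hk ih => exact fun h3 => h.inner_succ_eq_zero hs (by lia) (ih (by lia))

end Polygon

/-! ### Slopes, Pythagoras and the lower bound for the turning. -/

/-- The slope of the segment from `q j` to `q (j + 1)`, if it is perpendicular to `q j`. -/
noncomputable def slopeAt (q : ℕ → ℂ) (j : ℕ) : ℝ := ((q (j + 1) - q j) / q j).im

theorem isSpiral_of_inner_eq_zero {q : ℕ → ℂ} {n : ℕ} (hn : 1 ≤ n) (h0 : q 0 = 0)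
    (hne : ∀ j, 1 ≤ j → j ≤ n → q j ≠ 0) (hsucc : ∀ j < n, q (j + 1) ≠ q j)
    (hq : ∀ j, 1 ≤ j → j < n → inner ℝ (q j) (q (j + 1) - q j) = 0) :
    IsSpiral q (slopeAt q) n where
  pos := hn
  zero := h0
  one_ne := hne 1 le_rfl hn
  slope_ne j h1 hj := by
    intro h
    have h2 := norm_eq_abs_im_div_of_inner_eq_zero (hne j h1 hj.le) (hq j h1 hj)
    rw [slopeAt] at h
    rw [h, abs_zero, mul_zero, norm_eq_zero, sub_eq_zero] at h2
    exact hsucc j hj h2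
  step j h1 hj := eq_mul_one_add_of_inner_eq_zero (hne j h1 hj.le) (hq j h1 hj)

theorem IsSpiral.norm_sq_eq_sum {q : ℕ → ℂ} {n : ℕ} (h : IsSpiral q (slopeAt q) n)
    (hq : ∀ j, 1 ≤ j → j < n → inner ℝ (q j) (q (j + 1) - q j) = 0) {j : ℕ} (hj : j ≤ n) :
    ‖q j‖ ^ 2 = ∑ i ∈ Finset.range j, ‖q (i + 1) - q i‖ ^ 2 := by
  induction j with
  | zero => simp [h.zero]
  | succ j ih =>
    rw [Finset.sum_range_succ, ← ih (by lia)]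
    rcases Nat.eq_zero_or_pos j with rfl | h1
    · simp [h.zero]
    · have h2 := norm_add_sq_real (q j) (q (j + 1) - q j)
      rw [hq j h1 (by lia), add_sub_cancel] at h2
      linarith

/-- From `t j ^ 2 ≥ 1 / j` one gets `|arctan (t j)| ≥ 1 / √(j + 1)`, which is at least the
telescoping term `2 * (√(j + 2) - √(j + 1))`. -/
theorem two_mul_sqrt_sub_le_sum_arctan {t : ℕ → ℝ} {m : ℕ} (hm : 1 ≤ m)
    (ht : ∀ j, 1 ≤ j → j < m → 1 ≤ j * t j ^ 2) :
    2 * (√(m + 1) - √2) ≤ ∑ j ∈ Finset.Ico 1 m, |arctan (t j)| := by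
  induction m, hm using Nat.le_induction with
  | base => norm_num
  | succ m hm ih =>
    rw [Finset.sum_Ico_succ_top hm]
    have h1 := ih fun j h1 h2 => ht j h1 (by lia)
    have h2 : 2 * (√(m + 1 + 1) - √(m + 1)) ≤ |arctan (t m)| := by
      have h3 : |t m| / √(1 + |t m| ^ 2) ≤ |arctan (t m)| := by
        refine (div_sqrt_one_add_sq_le_arctan (abs_nonneg (t m))).trans_eq ?_
        rcases abs_cases (t m) with ⟨h4, h5⟩ | ⟨h4, h5⟩
        · rw [h4, abs_of_nonneg (Real.arctan_nonneg.2 h5)]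
        · rw [h4, Real.arctan_neg, abs_of_neg (Real.arctan_lt_zero.2 h5)]
      have h4 : 1 / √(m + 1) ≤ |t m| / √(1 + |t m| ^ 2) := by
        rw [div_le_div_iff₀ (by positivity) (by positivity), one_mul, sq_abs]
        apply Real.sqrt_le_iff.2
        refine ⟨by positivity, ?_⟩
        rw [mul_pow, sq_abs, Real.sq_sqrt (by positivity)]
        linarith [ht m hm (by lia)]
      refine le_trans ?_ (h4.trans h3)
      rw [le_div_iff₀ (by positivity)]
      have h5 : √((m : ℝ) + 1) ^ 2 = m + 1 := Real.sq_sqrt (by positivity)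
      have h6 : √((m : ℝ) + 1 + 1) ^ 2 = m + 1 + 1 := Real.sq_sqrt (by positivity)
      nlinarith [sq_nonneg (√((m : ℝ) + 1 + 1) - √(m + 1))]
    push_cast
    linarith

/-! ### Counting reflex vertices and the final estimate. -/

namespace Polygon

variable {N : ℕ} [NeZero N] {P : Polygon ℂ N}

/-- Outgoing vertices have index below `m` and return vertices `N - j` have index above `m`, so none
is counted twice. -/
theorem card_add_card_le_reflexCount {m : ℕ} (hm : m < N) {B B' : Finset ℕ}
    (hB : B ⊆ Finset.Ico 1 m) (hB' : B' ⊆ Finset.Ico 1 (N - m))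
    (h : ∀ j ∈ B, π < P.interiorAngle (Fin.ofNat N j))
    (h' : ∀ j ∈ B', π < P.interiorAngle (Fin.ofNat N (N - j))) :
    B.card + B'.card ≤ P.reflexCount := by
  classical
  have hinj : Set.InjOn (fun j => N - j) (B' : Set ℕ) := by
    intro i hi j hj hij
    have h1 := Finset.mem_Ico.1 (hB' hi)
    have h2 := Finset.mem_Ico.1 (hB' hj)
    simp only at hij
    lia
  have hdisj : Disjoint B (B'.image fun j => N - j) := by
    rw [Finset.disjoint_left]
    intro i hi hi'
    obtain ⟨j, hj, rfl⟩ := Finset.mem_image.1 hi'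
    have h1 := Finset.mem_Ico.1 (hB hi)
    have h2 := Finset.mem_Ico.1 (hB' hj)
    lia
  have hlt : ∀ i ∈ B ∪ B'.image fun j => N - j, i < N := by
    intro i hi
    rcases Finset.mem_union.1 hi with h1 | h1
    · have := Finset.mem_Ico.1 (hB h1)
      lia
    · obtain ⟨j, hj, rfl⟩ := Finset.mem_image.1 h1
      have h2 := Finset.mem_Ico.1 (hB' hj)
      lia
  rw [← Finset.card_image_of_injOn hinj, ← Finset.card_union_of_disjoint hdisj,
    ← Finset.card_image_of_injOn (f := fun k => Fin.ofNat N k), ← Set.ncard_coe_finset]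
  · refine Set.ncard_le_ncard ?_ (Set.toFinite _)
    intro i hi
    obtain ⟨k, hk, rfl⟩ := Finset.mem_image.1 (Finset.mem_coe.1 hi)
    rcases Finset.mem_union.1 hk with h1 | h1
    · exact h k h1
    · obtain ⟨j, hj, rfl⟩ := Finset.mem_image.1 h1
      exact h' j hj
  · intro i hi j hj hij
    have h1 := congrArg Fin.val hij
    simpa only [Fin.val_ofNat, Nat.mod_eq_of_lt (hlt i hi), Nat.mod_eq_of_lt (hlt j hj)] using h1

theorem pi_lt_interiorAngle {k : ℕ} {v : ℂ} (hv : P.relVertex k = v)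
    (h : π < volume.real {θ ∈ Ioc (-π) π |
      ∀ᶠ τ : ℝ in 𝓝[>] 0, P 0 + v + τ * Complex.exp (θ * Complex.I) ∈ P.inside}) :
    π < P.interiorAngle (Fin.ofNat N k) := by
  subst hv
  rwa [add_relVertex] at h

/-- The two halves of a simple arithmetic polygon form a pair of spirals. -/
theorem exists_isSpiralPair (hs : P.IsSimple) {m : ℕ} (hm : 1 ≤ m) (hmN : m < N)
    (h : IsSpiral P.relVertex (slopeAt P.relVertex) m)
    (h' : IsSpiral (fun j => P.relVertex (N - j)) (slopeAt fun j => P.relVertex (N - j)) (N - m)) :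
    ∃ α α', IsSpiralPair P.relVertex (slopeAt P.relVertex) m
        (fun j => P.relVertex (N - j)) (slopeAt fun j => P.relVertex (N - j)) (N - m)
        α α' (P 0) (P.boundary ℝ) ∨
      IsSpiralPair (fun j => P.relVertex (N - j)) (slopeAt fun j => P.relVertex (N - j)) (N - m)
        P.relVertex (slopeAt P.relVertex) m α' α (P 0) (P.boundary ℝ) := by
  set p := P.relVertex
  set q : ℕ → ℂ := fun j => p (N - j) with hq
  have hpm : p m = q (N - m) := by
    simp only [hq]
    congr 1
    lia
  have hnorm : ‖p m‖ = ‖q (N - m)‖ := by rw [hpm]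
  have hR : 0 < ‖p m‖ := h.norm_pos hm le_rfl
  obtain ⟨α, hα⟩ : ∃ α : ℝ, p 1 = ‖p 1‖ * Complex.exp (α * Complex.I) :=
    ⟨_, (Complex.norm_mul_exp_arg_mul_I _).symm⟩
  -- Among the lifts of `arg (q 1)`, choose the one for which the two angle functions agree at the
  -- common end.
  obtain ⟨α', hα', hend⟩ : ∃ α' : ℝ, q 1 = ‖q 1‖ * Complex.exp (α' * Complex.I) ∧
      α + sweep p (slopeAt p) m ‖p m‖ = α' + sweep q (slopeAt q) (N - m) ‖p m‖ := by
    have h1 : q 1 = ‖q 1‖ * Complex.exp (Complex.arg (q 1) * Complex.I) :=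
      (Complex.norm_mul_exp_arg_mul_I _).symm
    have h2 := h.end_eq hα
    have h3 := h'.end_eq h1
    rw [← hpm, h2] at h3
    have h4 : ‖(‖p m‖ : ℂ) * Complex.exp ((α + sweep p (slopeAt p) m ‖p m‖ : ℝ) * Complex.I)‖
      = ‖p m‖ := by rw [← h2]
    rw [h4] at h3
    have h5 : (‖p m‖ : ℂ) ≠ 0 := by exact_mod_cast hR.ne'
    obtain ⟨k, hk⟩ := Complex.exp_eq_exp_iff_exists_int.1 (mul_left_cancel₀ h5 h3)
    refine ⟨Complex.arg (q 1) + k * (2 * π), ?_, ?_⟩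
    · nth_rw 1 [h1]
      congr 1
      rw [Complex.exp_eq_exp_iff_exists_int]
      refine ⟨-k, ?_⟩
      push_cast
      ring
    · have := congrArg Complex.im hk
      simp only [Complex.add_im, Complex.mul_im, Complex.ofReal_re, Complex.ofReal_im, Complex.I_re,
        Complex.I_im, Complex.intCast_re, Complex.intCast_im] at this
      norm_num at this
      linarith
  -- Otherwise the two spirals would meet at radius `r`, on sides with indices below `m` and at
  -- least `m`.
  have hne : ∀ r ∈ Ioo 0 ‖p m‖, ∀ k : ℤ,
      (α' + sweep q (slopeAt q) (N - m) r) - (α + sweep p (slopeAt p) m r) ≠ k * (2 * π) := by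
    intro r hr k hk
    obtain ⟨i, hi, s, hs1, h1⟩ := h.exists_lineMap_eq hα hr.1.le hr.2
    obtain ⟨j, hj, u, hu1, h2⟩ := h'.exists_lineMap_eq hα' hr.1.le (hnorm ▸ hr.2)
    have h3 : (AffineMap.lineMap (p i) (p (i + 1)) s : ℂ) =
        AffineMap.lineMap (q j) (q (j + 1)) u := by
      rw [h1, h2]
      congr 1
      rw [Complex.exp_eq_exp_iff_exists_int]
      refine ⟨-k, ?_⟩
      rw [show α' + sweep q (slopeAt q) (N - m) r =
        α + sweep p (slopeAt p) m r + k * (2 * π) by linarith]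
      push_cast
      ring
    -- Reversal turns `[0, 1)` into `(0, 1]`, so the start `u = 0` of a reversed segment must be
    -- read as the start of the polygon side `N - j`.
    rcases hu1.1.eq_or_lt with h0 | h0
    · rw [← h0, AffineMap.lineMap_apply_zero] at h3
      rcases Nat.eq_zero_or_pos j with rfl | hj0
      · rw [h1, h'.zero] at h3
        have hr0 : (r : ℂ) ≠ 0 := by exact_mod_cast hr.1.ne'
        exact mul_ne_zero hr0 (Complex.exp_ne_zero _) h3
      · have := hs.eq_of_lineMap_eq (by lia : i < N) (by lia : N - j < N) hs1 (t := 0) (by simp)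
          (by rw [AffineMap.lineMap_apply_zero]; exact h3)
        lia
    · have h4 : N - j = N - (j + 1) + 1 := by lia
      have := hs.eq_of_lineMap_eq (by lia : i < N) (by lia : N - (j + 1) < N) hs1 (t := 1 - u)
        ⟨by linarith [hu1.2], by linarith⟩
        (by rw [AffineMap.lineMap_apply_one_sub, ← h4]; exact h3)
      lia
  have hmem : ∀ z, z ∈ P.boundary ℝ ↔
      (∃ j < m, ∃ s ∈ Icc (0 : ℝ) 1, z = P 0 + AffineMap.lineMap (p j) (p (j + 1)) s) ∨
      (∃ j < N - m, ∃ s ∈ Icc (0 : ℝ) 1, z = P 0 + AffineMap.lineMap (q j) (q (j + 1)) s) := by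
    intro z
    rw [mem_boundary_iff]
    constructor
    · rintro ⟨k, hk, s, hs1, rfl⟩
      rcases lt_or_ge k m with hkm | hkm
      · exact Or.inl ⟨k, hkm, s, hs1, rfl⟩
      · refine Or.inr ⟨N - 1 - k, by lia, 1 - s, ⟨by linarith [hs1.2], by linarith [hs1.1]⟩, ?_⟩
        rw [AffineMap.lineMap_apply_one_sub]
        simp only [hq]
        rw [show N - (N - 1 - k + 1) = k by lia, show N - (N - 1 - k) = k + 1 by lia]
    · rintro (⟨k, hk, s, hs1, rfl⟩ | ⟨j, hj, s, hs1, rfl⟩)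
      · exact ⟨k, by lia, s, hs1, rfl⟩
      · refine ⟨N - (j + 1), by lia, 1 - s, ⟨by linarith [hs1.2], by linarith [hs1.1]⟩, ?_⟩
        rw [AffineMap.lineMap_apply_one_sub]
        simp only [hq]
        rw [show N - j = N - (j + 1) + 1 by lia]
  refine ⟨α, α', ?_⟩
  have hcont : Continuous fun r =>
      (α' + sweep q (slopeAt q) (N - m) r) - (α + sweep p (slopeAt p) m r) :=
    ((continuous_sweep _ _ _).const_add _).sub ((continuous_sweep _ _ _).const_add _)
  rcases forall_mem_Ioo_or_of_ne_int_mul hcont (by linarith) hne with h1 | h1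
  · left
    exact
      { lower := h
        upper := h'
        lower_one := hα
        upper_one := hα'
        norm_end := hnorm
        sweep_end := hend
        lt := fun r hr => by linarith [(h1 r hr).1]
        lt_add := fun r hr => by linarith [(h1 r hr).2]
        mem_iff := hmem }
  · right
    exact
      { lower := h'
        upper := h
        lower_one := hα'
        upper_one := hα
        norm_end := hnorm.symm
        sweep_end := by rw [← hnorm]; exact hend.symm
        lt := fun r hr => by linarith [(h1 r (hnorm ▸ hr)).2]
        lt_add := fun r hr => by linarith [(h1 r (hnorm ▸ hr)).1]
        mem_iff := fun z => (hmem z).trans or_comm }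

theorem sum_abs_arctan_slopeAt_le (hs : P.IsSimple) {m : ℕ} (hm : 1 ≤ m) (hmN : m < N)
    (h : IsSpiral P.relVertex (slopeAt P.relVertex) m)
    (h' : IsSpiral (fun j => P.relVertex (N - j)) (slopeAt fun j => P.relVertex (N - j)) (N - m)) :
    ∑ j ∈ Finset.Ico 1 m, |arctan (slopeAt P.relVertex j)| ≤ π * (P.reflexCount + 2) := by
  have hnn : ∀ (q : ℕ → ℂ) (n : ℕ), 0 ≤ ∑ j ∈ Finset.Ico 1 n, |arctan (slopeAt q j)| :=
    fun q n => Finset.sum_nonneg fun _ _ => abs_nonneg _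
  have hin : ∀ z, z ∉ P.boundary ℝ ∧
      Bornology.IsBounded (connectedComponentIn (P.boundary ℝ)ᶜ z) → z ∈ P.inside := fun z hz => hz
  obtain ⟨α, α', hpair | hpair⟩ := exists_isSpiralPair hs hm hmN h h'
  · have h1 := hpair.sum_abs_arctan_le
    have h2 := card_add_card_le_reflexCount (P := P) hmN
      (Finset.filter_subset (fun j => slopeAt P.relVertex j < 0) _)
      (Finset.filter_subset (fun j => 0 < slopeAt (fun j => P.relVertex (N - j)) j) _)
      (fun j hj => by
        rw [Finset.mem_filter, Finset.mem_Ico] at hj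
        exact pi_lt_interiorAngle rfl (hpair.pi_lt_volume_lower hj.1.1 hj.1.2 hj.2 hin))
      (fun j hj => by
        rw [Finset.mem_filter, Finset.mem_Ico] at hj
        exact pi_lt_interiorAngle rfl (hpair.pi_lt_volume_upper hj.1.1 hj.1.2 hj.2 hin))
    have h3 := mul_le_mul_of_nonneg_left (Nat.cast_le (α := ℝ).2 h2) pi_pos.le
    push_cast at h3
    linarith [hnn (fun j => P.relVertex (N - j)) (N - m)]
  · have h1 := hpair.sum_abs_arctan_le
    have h2 := card_add_card_le_reflexCount (P := P) hmN
      (Finset.filter_subset (fun j => 0 < slopeAt P.relVertex j) _)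
      (Finset.filter_subset (fun j => slopeAt (fun j => P.relVertex (N - j)) j < 0) _)
      (fun j hj => by
        rw [Finset.mem_filter, Finset.mem_Ico] at hj
        exact pi_lt_interiorAngle rfl (hpair.pi_lt_volume_upper hj.1.1 hj.1.2 hj.2 hin))
      (fun j hj => by
        rw [Finset.mem_filter, Finset.mem_Ico] at hj
        exact pi_lt_interiorAngle rfl (hpair.pi_lt_volume_lower hj.1.1 hj.1.2 hj.2 hin))
    have h3 := mul_le_mul_of_nonneg_left (Nat.cast_le (α := ℝ).2 h2) pi_pos.le
    push_cast at h3
    linarith [hnn (fun j => P.relVertex (N - j)) (N - m)]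

theorem card_sides_le (hs : P.IsSimple) (ha : P.IsArithmetic) :
    (N : ℝ) ≤ 8 + 3 * π ^ 2 * ((P.reflexCount : ℝ) + 2) ^ 2 := by
  rcases le_or_gt N 8 with hN | hN
  · have : (N : ℝ) ≤ 8 := by exact_mod_cast hN
    have : 0 ≤ 3 * π ^ 2 * ((P.reflexCount : ℝ) + 2) ^ 2 := by positivity
    linarith
  obtain ⟨m, hm, hmN, hout, hback⟩ := ha.exists_turning_vertex hs (by lia)
  obtain ⟨a, hlen⟩ := ha.exists_norm_sub
  have h : IsSpiral P.relVertex (slopeAt P.relVertex) m :=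
    isSpiral_of_inner_eq_zero hm P.relVertex_zero
      (fun j h1 h2 => hs.relVertex_ne_zero h1 (by lia))
      (fun j hj => ha.relVertex_succ_ne (by lia)) hout
  have hback' : ∀ j, 1 ≤ j → j < N - m →
      inner ℝ (P.relVertex (N - j)) (P.relVertex (N - (j + 1)) - P.relVertex (N - j)) = 0 := by
    intro j h1 h2
    have h3 := hback (N - (j + 1)) (by lia) (by lia)
    rw [show N - (j + 1) + 1 = N - j by lia] at h3
    rw [← neg_sub, inner_neg_right, h3, neg_zero]
  have h' : IsSpiral (fun j => P.relVertex (N - j)) (slopeAt fun j => P.relVertex (N - j))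
      (N - m) := by
    refine isSpiral_of_inner_eq_zero (by lia) P.relVertex_self
      (fun j h1 h2 => hs.relVertex_ne_zero (by lia) (by lia)) (fun j hj => ?_) hback'
    have := (ha.relVertex_succ_ne (by lia : N - (j + 1) < N)).symm
    rwa [show N - (j + 1) + 1 = N - j by lia] at this
  have hS := sum_abs_arctan_slopeAt_le hs hm hmN h h'
  have hsum : ∀ j ≤ m, ‖P.relVertex j‖ ^ 2 = ∑ i ∈ Finset.range j, ((a : ℝ) + 1 + i) ^ 2 := by
    intro j hj
    rw [h.norm_sq_eq_sum hout hj]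
    refine Finset.sum_congr rfl fun i hi => ?_
    rw [hlen i (by have := Finset.mem_range.1 hi; lia)]
  -- `‖P.relVertex j‖ ^ 2` is a sum of `j` squares, each at most the square of the next side length
  -- `‖P.relVertex j‖ * |t j|`.
  have hslope : ∀ j, 1 ≤ j → j < m → 1 ≤ j * slopeAt P.relVertex j ^ 2 := by
    intro j h1 h2
    have hj0 := hs.relVertex_ne_zero h1 (by lia : j < N)
    have h3 := norm_eq_abs_im_div_of_inner_eq_zero hj0 (hout j h1 h2)
    rw [hlen j (by lia)] at h3
    have h4 : ‖P.relVertex j‖ ^ 2 ≤ j * ((a : ℝ) + 1 + j) ^ 2 := by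
      rw [hsum j h2.le, ← nsmul_eq_mul]
      refine (Finset.sum_le_card_nsmul _ _ (((a : ℝ) + 1 + j) ^ 2) fun i hi => ?_).trans_eq
        (by rw [Finset.card_range])
      have : (i : ℝ) ≤ j := by exact_mod_cast (Finset.mem_range.1 hi).le
      gcongr
    rw [h3, mul_pow, sq_abs] at h4
    have h5 : 0 < ‖P.relVertex j‖ ^ 2 := by have := norm_pos_iff.2 hj0; positivity
    rw [slopeAt]
    by_contra! h6
    nlinarith
  -- Both halves compute `‖P.relVertex m‖ ^ 2` as a sum of squares; if there were at least `m`
  -- return sides, all longer than the outgoing ones, their sum would be strictly larger.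
  have hhalf : N < 2 * m := by
    by_contra! h1
    have h2 := hsum m le_rfl
    have h3 := h'.norm_sq_eq_sum hback' (j := N - m) le_rfl
    simp only [show N - (N - m) = m by lia] at h3
    have h4 : ∑ i ∈ Finset.range (N - m),
        ‖P.relVertex (N - (i + 1)) - P.relVertex (N - i)‖ ^ 2 =
        ∑ i ∈ Finset.range (N - m), ((a : ℝ) + 1 + (m + i : ℕ)) ^ 2 := by
      rw [← Finset.sum_range_reflect]
      refine Finset.sum_congr rfl fun i hi => ?_
      have hi := Finset.mem_range.1 hi
      rw [← hlen (m + i) (by lia), norm_sub_rev, show N - (N - m - 1 - i + 1) = m + i by lia,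
        show N - (N - m - 1 - i) = m + i + 1 by lia]
    rw [h4, h2] at h3
    have h5 : ∑ i ∈ Finset.range m, ((a : ℝ) + 1 + i) ^ 2 <
        ∑ i ∈ Finset.range m, ((a : ℝ) + 1 + (m + i : ℕ)) ^ 2 := by
      refine Finset.sum_lt_sum_of_nonempty (Finset.nonempty_range_iff.2 (by lia)) fun i _ => ?_
      have : (0 : ℝ) < m := by exact_mod_cast hm
      push_cast
      gcongr
      linarith
    have h6 : ∑ i ∈ Finset.range m, ((a : ℝ) + 1 + (m + i : ℕ)) ^ 2 ≤
        ∑ i ∈ Finset.range (N - m), ((a : ℝ) + 1 + (m + i : ℕ)) ^ 2 :=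
      Finset.sum_le_sum_of_subset_of_nonneg (Finset.range_mono (by lia))
        fun _ _ _ => by positivity
    linarith
  have hL := (two_mul_sqrt_sub_le_sum_arctan hm hslope).trans hS
  have hm1 : (N : ℝ) ≤ 2 * m - 1 := by
    have : N + 1 ≤ 2 * m := hhalf
    have : (N : ℝ) + 1 ≤ 2 * m := by exact_mod_cast this
    linarith
  have hu : √((m : ℝ) + 1) ^ 2 = m + 1 := Real.sq_sqrt (by positivity)
  have hw : √(2 : ℝ) ^ 2 = 2 := Real.sq_sqrt (by norm_num)
  have hle : √(2 : ℝ) ≤ √((m : ℝ) + 1) := by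
    have : (1 : ℝ) ≤ m := by exact_mod_cast hm
    exact Real.sqrt_le_sqrt (by linarith)
  have hsq := pow_le_pow_left₀ (by linarith) hL 2
  rw [mul_pow π] at hsq
  -- With `u = √(m + 1)` and `w = √2`, it suffices that `2u² - 3 ≤ 8 + 12(u - w)²`, that is `10u² -
  -- 24uw + 35 ≥ 0`, a quadratic in `u` of negative discriminant.
  nlinarith [sq_nonneg (5 * √((m : ℝ) + 1) - 12 * √2)]

end Polygon

theorem theorem3p2 {N : ℕ} [NeZero N] (P : Polygon ℂ N)
    (hsimple : P.IsSimple) (harith : P.IsArithmetic) :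
    (∀ ν : ℝ, (P.reflexCount : ℝ) ≤ ν → (N : ℝ) ≤ 8 + 3 * π ^ 2 * (ν + 2) ^ 2) ∧
      (P.IsConvex → N ≤ 126) := by
  have h := Polygon.card_sides_le hsimple harith
  refine ⟨fun ν hν => h.trans (by gcongr), fun hconv => ?_⟩
  rw [hconv.reflexCount_eq_zero] at h
  -- With no reflex angle the bound is `8 + 12π²`, about `126.4`.
  have h1 := Real.pi_lt_d4
  have h2 := Real.pi_pos
  have h3 : (N : ℝ) < 127 := by
    push_cast at h
    nlinarith
  have h4 : N < 127 := by exact_mod_cast h3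
  lia
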